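/- Let $k\ge 0$, let $F_k=\langle a_1,\dots,a_k\mid -\rangle$ be the free group of rank $k$, and let $X=\{a_1^{\pm1},\dots,a_k^{\pm1}\}$, a finite symmetric generating set of $F_k$. Write $X^*$ for the set of finite words over $X$ and $\overline{w}\in F_k$ for the element represented by $w\in X^*$. Let $L\subseteq X^*$ be the set of freely reduced words, that is, words without a subword $xx^{-1}$, $x\in X$ (where $(a_i^{-1})^{-1}=a_i$). A function $f:X^*\to X^*$ is called \emph{logspace computable} if it is computed by a deterministic Turing machine that halts on every input and has a finite state control, a read-only input tape, a read-write work tape on which it uses $O(\log n)$ squares on inputs of length $n\geq 2$ (and a bounded number of squares on inputs of length at most $1$), and a write-only output tape written from left to right, a bounded number of letters per transition. Then $L$ is a normal form for $F_k$, i.e. $w\mapsto\overline{w}$ restricts to a bijection $L\to F_k$, and there is a logspace computable function $f:X^*\to X^*$ such that, for every $w\in X^*$, $f(w)$ is the normal form word for $w$, i.e. the unique word in $L$ with $\overline{f(w)}=\overline{w}$. -/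

import Mathlib

/-- Head moves. On a tape whose squares are numbered by `ℕ`, moving left from square `0` leaves the
head where it is. -/
inductive HeadMove : Type where
  | left
  | stay
  | right

def HeadMove.apply : HeadMove → ℕ → ℕ
  | .left, i => i - 1
  | .stay, i => i
  | .right, i => i + 1

/-- The symbols on the input tape: the letters of the input word, enclosed by two end markers. -/
inductive InputSymbol (X : Type) : Type where
  | leftEnd
  | letter (x : X)
  | rightEnd

/-- The input tape carrying the word `w` of length `n`: the left end marker is on square `0`, the
letters of `w` are on squares `1, …, n`, the right end marker is on square `n + 1`. -/
def inputSymbolAt {X : Type} (w : List X) : ℕ → InputSymbol X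
  | 0 => .leftEnd
  | i + 1 => (w[i]?).elim .rightEnd .letter

/-- What a transducer does in one transition: it changes its state, overwrites the scanned square of
the work tape, moves the input head and the work head, and appends a word to the output. -/
structure TransducerAction (Y Q Γ : Type) : Type where
  state : Q
  write : Γ
  moveInput : HeadMove
  moveWork : HeadMove
  output : List Y

/-- A deterministic transducer with a read-only input tape over `X`, one read-write work tape and a
write-only output tape over `Y`. The transition function sees the state, the scanned input symbol
and the scanned work symbol; the value `none` means that the machine halts. Since `X`, the set of
states and the work alphabet are finite, the number of letters written in one transition is bounded
by a constant of the machine. -/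
structure Transducer (X Y : Type) [Finite X] [Finite Y] : Type 1 where
  State : Type
  WorkSymbol : Type
  finite_state : Finite State
  finite_workSymbol : Finite WorkSymbol
  start : State
  blank : WorkSymbol
  transition : State → InputSymbol X → WorkSymbol → Option (TransducerAction Y State WorkSymbol)

namespace Transducer

/-- A configuration of a transducer (for a given input word). -/
structure Config {X Y : Type} [Finite X] [Finite Y] (M : Transducer X Y) : Type where
  state : M.State
  inputHead : ℕ
  work : ℕ → M.WorkSymbol
  workHead : ℕ
  output : List Y

/-- The initial configuration: the input head is on the first square after the left end marker, the
work tape is blank with its head on square `0`, and nothing has been written. -/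
def init {X Y : Type} [Finite X] [Finite Y] (M : Transducer X Y) : M.Config where
  state := M.start
  inputHead := 1
  work := fun _ => M.blank
  workHead := 0
  output := []

/-- One step on the input word `w`, or `none` if the machine halts. The input head never leaves the
squares `0, …, w.length + 1`. -/
def step {X Y : Type} [Finite X] [Finite Y] (M : Transducer X Y) (w : List X) (c : M.Config) :
    Option M.Config :=
  (M.transition c.state (inputSymbolAt w c.inputHead) (c.work c.workHead)).map fun a =>
    { state := a.state
      inputHead := min (a.moveInput.apply c.inputHead) (w.length + 1)
      work := Function.update c.work c.workHead a.write
      workHead := a.moveWork.apply c.workHead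
      output := c.output ++ a.output }

/-- On input `w` the machine halts with the word `v` on its output tape. -/
def Outputs {X Y : Type} [Finite X] [Finite Y] (M : Transducer X Y) (w : List X) (v : List Y) :
    Prop :=
  ∃ c : M.Config, StateTransition.Reaches (M.step w) M.init c ∧ M.step w c = none ∧ c.output = v

/-- On input `w` the work head only ever visits the first `s` squares of the work tape. -/
def UsesSpaceAtMost {X Y : Type} [Finite X] [Finite Y] (M : Transducer X Y) (w : List X) (s : ℕ) :
    Prop :=
  ∀ c : M.Config, StateTransition.Reaches (M.step w) M.init c → c.workHead < s

/-- The machine uses `O(log n)` squares of its work tape on inputs of length `n`. The summand `1`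
only matters for `n ≤ 1`, where `log n` leaves no square for the work head to stand on. -/
def IsLogspace {X Y : Type} [Finite X] [Finite Y] (M : Transducer X Y) : Prop :=
  ∃ c : ℕ, ∀ w : List X, M.UsesSpaceAtMost w (c * (Nat.log 2 w.length + 1))

end Transducer

/-- `f : X* → Y*` is computed by a deterministic logspace transducer. -/
def LogspaceComputable {X Y : Type} [Finite X] [Finite Y] (f : List X → List Y) : Prop :=
  ∃ M : Transducer X Y, M.IsLogspace ∧ ∀ w : List X, M.Outputs w (f w)

/-- The element of `G` represented by a word, where the letter `x` stands for the element `ρ x`. -/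
def wordValue {X G : Type} [Group G] (ρ : X → G) (w : List X) : G :=
  (w.map ρ).prod

/-- The letters in `X` stand, via `ρ`, for the distinct elements of a symmetric generating set
of `G`. -/
structure IsSymmetricGeneratingSet {X G : Type} [Group G] (ρ : X → G) : Prop where
  injective : Function.Injective ρ
  symmetric : ∀ x : X, ∃ y : X, ρ y = (ρ x)⁻¹
  generates : Subgroup.closure (Set.range ρ) = ⊤

/-- A normal form for `G` with finite symmetric generating set `X`: a set of words over `X` that is
in bijection with `G` under the map sending a word to the element that it represents. -/
structure IsNormalForm {X G : Type} [Finite X] [Group G] (ρ : X → G) (L : Set (List X)) :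
    Prop where
  symmetricGenerating : IsSymmetricGeneratingSet ρ
  bijOn : Set.BijOn (wordValue ρ) L Set.univ

/-- `f` is logspace computable, and for every word `w` the word `f w` is the word of `L` that
represents the same element of `G` as `w`. -/
structure IsLogspaceNormalFormFunction {X G : Type} [Finite X] [Group G] (ρ : X → G)
    (L : Set (List X)) (f : List X → List X) : Prop where
  logspaceComputable : LogspaceComputable f
  mem : ∀ w : List X, f w ∈ L
  value_eq : ∀ w : List X, wordValue ρ (f w) = wordValue ρ w

/-- The letters `a_i` (as `(i, true)`) and `a_i⁻¹` (as `(i, false)`) in the free group on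
`a_0, …, a_{k-1}`. -/
def freeGroupLetter (k : ℕ) (x : Fin k × Bool) : FreeGroup (Fin k) :=
  if x.2 then FreeGroup.of x.1 else (FreeGroup.of x.1)⁻¹

/-! The word problem of a free group is decided in logarithmic space by a faithful integral linear
action evaluated modulo small integers, and the reduced form is then obtained from the word problem
alone.

Let `X` be the set of letters and let r_x be the reflection of ℤ^X that replaces v_x by 3 ∑_{y ≠ x}
v_y − v_x. A letter x acts as r_x followed by the reflection in the inverse letter, so inverse
letters act inversely, and in a reduced word no two consecutive reflections agree. Along such a
sequence, started at the all-ones vector, the coordinate changed last is always the unique largest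
one (`dominates_reflect_one`, `Dominates.reflect`). Hence a word is trivial if and only if it fixes
the all-ones vector (`wordAct_one_eq_one_iff`).

A word of length at most n produces coordinates of absolute value at most K ^ n, with K depending
only on the rank. An integer divisible by all m ≤ 2N is a multiple of the central binomial
coefficient of N, which is at least 2 ^ N (`eq_zero_of_forall_dvd`). So it suffices to test all
moduli up to a constant multiple of n (`reduce_eq_nil_of_forall_modulus`), and this takes a fixed
number of registers with O(log n) binary digits.

For the reduced form, consider the first unread letter. If some nonempty factor starting there is
trivial, that factor is skipped. Otherwise the letter survives in the reduced form
(`reduce_cons_of_forall_prefix`) and is written.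

The machine is assembled from fragments of transition tables. The predicate `Fragment.WP` carries
correctness, termination and the space bound through this assembly, so that the algorithm is
verified like a structured program. -/

/-! ### Composable fragments of transducers -/

/-- What a transducer remembers apart from its state. -/
structure Memory (Y Γ : Type) : Type where
  inputHead : ℕ
  work : ℕ → Γ
  workHead : ℕ
  output : List Y

/-- The effect of an action on the memory, on an input word of length `n`. -/
def Memory.apply {Y Γ Q : Type} (n : ℕ) (s : Memory Y Γ) (a : TransducerAction Y Q Γ) :
    Memory Y Γ where
  inputHead := min (a.moveInput.apply s.inputHead) (n + 1)
  work := Function.update s.work s.workHead a.write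
  workHead := a.moveWork.apply s.workHead
  output := s.output ++ a.output

/-- A fragment of the transition table of a transducer, with one entry and with exits labelled by
the elements of `E`. -/
structure Fragment (X Y Γ E : Type) : Type 1 where
  Point : Type
  finite_point : Finite Point
  entry : Point
  transition : Point → InputSymbol X → Γ → TransducerAction Y (Point ⊕ E) Γ

/-- The same action, with another next state. -/
def TransducerAction.mapState {Y Q Q' Γ : Type} (a : TransducerAction Y Q Γ) (f : Q → Q') :
    TransducerAction Y Q' Γ where
  state := f a.state
  write := a.write
  moveInput := a.moveInput
  moveWork := a.moveWork
  output := a.output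

theorem TransducerAction.state_mapState_of_eq {Y Q Q' Γ : Type} {a : TransducerAction Y Q Γ}
    (f : Q → Q') {q : Q} (h : a.state = q) : (a.mapState f).state = f q := congrArg f h

namespace Fragment

variable {X Y Γ E E' A : Type}

/-- The action taken at the control point `p` with memory `s` on input `w`. -/
def action (F : Fragment X Y Γ E) (w : List X) (p : F.Point) (s : Memory Y Γ) :
    TransducerAction Y (F.Point ⊕ E) Γ :=
  F.transition p (inputSymbolAt w s.inputHead) (s.work s.workHead)

/-- Started at the point `p` with memory `s`, the fragment leaves through the exit `e` with memory
`s'`, and the work head stays among the first `S` squares until then. -/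
inductive RunsFrom (F : Fragment X Y Γ E) (w : List X) (S : ℕ) (e : E) (s' : Memory Y Γ) :
    F.Point → Memory Y Γ → Prop
  | exit (p : F.Point) (s : Memory Y Γ) (hs : s.workHead < S)
      (he : (F.action w p s).state = .inr e)
      (hm : s.apply w.length (F.action w p s) = s') : RunsFrom F w S e s' p s
  | next (p p' : F.Point) (s : Memory Y Γ) (hs : s.workHead < S)
      (he : (F.action w p s).state = .inl p')
      (hr : RunsFrom F w S e s' p' (s.apply w.length (F.action w p s))) : RunsFrom F w S e s' p s

/-- A run of the fragment from its entry. -/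
def Runs (F : Fragment X Y Γ E) (w : List X) (S : ℕ) (s : Memory Y Γ) (e : E)
    (s' : Memory Y Γ) : Prop :=
  F.RunsFrom w S e s' F.entry s

/-- A single transition. -/
def prim (t : InputSymbol X → Γ → TransducerAction Y E Γ) : Fragment X Y Γ E where
  Point := Unit
  finite_point := inferInstance
  entry := ()
  transition _ x g := (t x g).mapState .inr

theorem runs_prim (t : InputSymbol X → Γ → TransducerAction Y E Γ) {w : List X} {S : ℕ}
    {s s' : Memory Y Γ} (hs : s.workHead < S) (a : TransducerAction Y E Γ) {e : E}
    (ha : t (inputSymbolAt w s.inputHead) (s.work s.workHead) = a) (he : a.state = e)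
    (hs' : s.apply w.length a = s') : (prim t).Runs w S s e s' := by
  subst ha he hs'
  exact .exit _ _ hs rfl rfl

/-- Run `F`, then the fragment chosen by the exit of `F`. -/
def bind [Finite E] (F : Fragment X Y Γ E) (G : E → Fragment X Y Γ E') : Fragment X Y Γ E' where
  Point := F.Point ⊕ Σ e, (G e).Point
  finite_point :=
    have := F.finite_point
    have := fun e => (G e).finite_point
    inferInstance
  entry := .inl F.entry
  transition
    | .inl p, x, g => (F.transition p x g).mapState
        (Sum.elim (fun p' => .inl (.inl p')) fun e => .inl (.inr ⟨e, (G e).entry⟩))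
    | .inr ⟨e, p⟩, x, g => ((G e).transition p x g).mapState
        (Sum.elim (fun p' => .inl (.inr ⟨e, p'⟩)) .inr)

theorem runs_bind [Finite E] {F : Fragment X Y Γ E} {G : E → Fragment X Y Γ E'} {w : List X}
    {S : ℕ} {s s' s'' : Memory Y Γ} {e : E} {e' : E'} (hF : F.Runs w S s e s')
    (hG : (G e).Runs w S s' e' s'') : (F.bind G).Runs w S s e' s'' := by
  have second : ∀ p t, (G e).RunsFrom w S e' s'' p t →
      (F.bind G).RunsFrom w S e' s'' (.inr ⟨e, p⟩) t := by
    intro p t h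
    induction h with
    | exit p t hs he hm =>
      exact .exit _ _ hs (TransducerAction.state_mapState_of_eq _ he) hm
    | next p p' t hs he _ ih =>
      exact .next _ _ _ hs (TransducerAction.state_mapState_of_eq _ he) ih
  have first : ∀ p t, F.RunsFrom w S e s' p t → (F.bind G).RunsFrom w S e' s'' (.inl p) t := by
    intro p t h
    induction h with
    | exit p t hs he hm =>
      exact .next _ _ _ hs (TransducerAction.state_mapState_of_eq _ he) (by
        have := second _ _ hG
        rwa [← hm] at this)
    | next p p' t hs he _ ih =>
      exact .next _ _ _ hs (TransducerAction.state_mapState_of_eq _ he) ih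
  exact first _ _ hF

/-- Run `F a`; on exit `.inl a'` go on with `F a'`, on exit `.inr e` leave. -/
def iter [Finite A] (F : A → Fragment X Y Γ (A ⊕ E)) (a : A) : Fragment X Y Γ E where
  Point := Σ a, (F a).Point
  finite_point :=
    have := fun a => (F a).finite_point
    inferInstance
  entry := ⟨a, (F a).entry⟩
  transition p x g := ((F p.1).transition p.2 x g).mapState
    (Sum.elim (fun p' => .inl ⟨p.1, p'⟩) (Sum.elim (fun a' => .inl ⟨a', (F a').entry⟩) .inr))

theorem runs_iter_exit [Finite A] {F : A → Fragment X Y Γ (A ⊕ E)} {a : A} {w : List X}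
    {S : ℕ} {s s' : Memory Y Γ} {e : E} (h : (F a).Runs w S s (.inr e) s') :
    (iter F a).Runs w S s e s' := by
  have key : ∀ p t, (F a).RunsFrom w S (.inr e) s' p t →
      (iter F a).RunsFrom w S e s' ⟨a, p⟩ t := by
    intro p t h
    induction h with
    | exit p t hs he hm =>
      exact .exit _ _ hs (TransducerAction.state_mapState_of_eq _ he) hm
    | next p p' t hs he _ ih =>
      exact .next _ _ _ hs (TransducerAction.state_mapState_of_eq _ he) ih
  exact key _ _ h

/-- `iter F a` and `iter F a'` share points and transitions and differ only in the entry. -/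
theorem runsFrom_iter_entry [Finite A] {F : A → Fragment X Y Γ (A ⊕ E)} (a : A) {a' : A}
    {w : List X} {S : ℕ} {s s' : Memory Y Γ} {e : E} {p : (iter F a').Point}
    (h : (iter F a').RunsFrom w S e s' p s) : (iter F a).RunsFrom w S e s' p s := by
  induction h with
  | exit p s hs he hm => exact .exit _ _ hs he hm
  | next p p' s hs he _ ih => exact .next _ _ _ hs he ih

theorem runs_iter_next [Finite A] {F : A → Fragment X Y Γ (A ⊕ E)} {a a' : A} {w : List X}
    {S : ℕ} {s s' s'' : Memory Y Γ} {e : E} (h : (F a).Runs w S s (.inl a') s')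
    (h' : (iter F a').Runs w S s' e s'') : (iter F a).Runs w S s e s'' := by
  have key : ∀ p t, (F a).RunsFrom w S (.inl a') s' p t →
      (iter F a).RunsFrom w S e s'' ⟨a, p⟩ t := by
    intro p t h
    induction h with
    | exit p t hs he hm =>
      exact .next _ _ _ hs (TransducerAction.state_mapState_of_eq _ he) (by
        have := runsFrom_iter_entry a h'
        rw [← hm] at this
        exact this)
    | next p p' t hs he _ ih =>
      exact .next _ _ _ hs (TransducerAction.state_mapState_of_eq _ he) ih
  exact key _ _ h

/-- The transducer that runs a fragment and halts when the fragment is left. -/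
def toTransducer [Finite X] [Finite Y] [Finite Γ] (F : Fragment X Y Γ E) (blank : Γ) :
    Transducer X Y where
  State := Option F.Point
  WorkSymbol := Γ
  finite_state := have := F.finite_point; inferInstance
  finite_workSymbol := inferInstance
  start := some F.entry
  blank := blank
  transition p x g :=
    p.map fun p => (F.transition p x g).mapState (Sum.elim some fun _ => none)

variable [Finite X] [Finite Y] [Finite Γ]

/-- The configuration of `F.toTransducer blank` at a control point, or after halting. -/
def config (F : Fragment X Y Γ E) (blank : Γ) (p : Option F.Point) (s : Memory Y Γ) :
    (F.toTransducer blank).Config where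
  state := p
  inputHead := s.inputHead
  work := s.work
  workHead := s.workHead
  output := s.output

theorem step_config (F : Fragment X Y Γ E) (blank : Γ) (w : List X) (p : F.Point)
    (s : Memory Y Γ) :
    (F.toTransducer blank).step w (F.config blank (some p) s) =
      some (F.config blank ((F.action w p s).state.elim some fun _ => none)
        (s.apply w.length (F.action w p s))) := rfl

/-- By determinism every reachable configuration lies on the single run described by `RunsFrom`, so
the space bound along that run covers all of them. The halting configuration lies beyond the last
transition, which is why `hs'` is needed. -/
theorem reaches_of_runsFrom {F : Fragment X Y Γ E} {w : List X} {S : ℕ} {e : E}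
    {s' : Memory Y Γ} (blank : Γ) (hs' : s'.workHead < S) {p : F.Point} {s : Memory Y Γ}
    (h : F.RunsFrom w S e s' p s) :
    StateTransition.Reaches ((F.toTransducer blank).step w) (F.config blank (some p) s)
        (F.config blank none s') ∧
      ∀ c, StateTransition.Reaches ((F.toTransducer blank).step w)
        (F.config blank (some p) s) c → c.workHead < S := by
  induction h with
  | exit p s hs he hm =>
    have hstep := F.step_config blank w p s
    rw [he, hm] at hstep
    refine ⟨.single hstep, fun c hc => ?_⟩
    rcases Relation.ReflTransGen.cases_head hc with rfl | ⟨d, hd, hdc⟩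
    · exact hs
    · rw [hstep] at hd
      obtain rfl := Option.some.inj hd
      rcases Relation.ReflTransGen.cases_head hdc with rfl | ⟨d, hd, -⟩
      · exact hs'
      · cases hd
  | next p p' s hs he _ ih =>
    have hstep := F.step_config blank w p s
    rw [he] at hstep
    refine ⟨.head hstep ih.1, fun c hc => ?_⟩
    rcases Relation.ReflTransGen.cases_head hc with rfl | ⟨d, hd, hdc⟩
    · exact hs
    · rw [hstep] at hd
      obtain rfl := Option.some.inj hd
      exact ih.2 c hdc

end Fragment

/-! ### Registers in binary on the tracks of the work tape -/

/-- Finitely many registers that hold natural numbers, the position of the input head and the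
output written so far. -/
@[ext]
structure Store (I Y : Type) : Type where
  inputHead : ℕ
  reg : I → ℕ
  output : List Y

/-- The work tape with blank square `0` and with the columns `col 0, …, col (U - 1)` on the squares
`1, …, U`. -/
def columns {I : Type} (col : ℕ → I → Bool) (U : ℕ) : ℕ → Option (I → Bool)
  | 0 => none
  | i + 1 => if i < U then some (col i) else none

/-- The binary digits of the registers, least significant first. -/
def digits {I : Type} (R : I → ℕ) (i : ℕ) : I → Bool := fun r => (R r).testBit i

namespace Store

variable {I X Y : Type}

/-- The store laid out on the first `U + 1` squares of the work tape, with the work head at rest. -/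
def memory (σ : Store I Y) (U : ℕ) : Memory Y (Option (I → Bool)) where
  inputHead := σ.inputHead
  work := columns (digits σ.reg) U
  workHead := 0
  output := σ.output

/-- The registers fit into `U ≤ B` binary digits. -/
structure Fits (w : List X) (B : ℕ) (σ : Store I Y) (U : ℕ) : Prop where
  inputHead_le : σ.inputHead ≤ w.length + 1
  le_bound : U ≤ B
  lt_two_pow : ∀ r, σ.reg r < 2 ^ U

end Store

namespace Fragment

variable {I X Y E E' A : Type}

/-- Weakest precondition: started with the store `σ`, the fragment is left with an exit and a store
that satisfy `Q`, and it never needs more than `B` digits for a register. -/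
def WP (F : Fragment X Y (Option (I → Bool)) E) (w : List X) (B : ℕ)
    (Q : E → Store I Y → Prop) (σ : Store I Y) : Prop :=
  ∀ U, σ.Fits w B U → ∃ e σ' U', σ'.Fits w B U' ∧
    F.Runs w (B + 2) (σ.memory U) e (σ'.memory U') ∧ Q e σ'

variable {w : List X} {B : ℕ}

theorem wp_bind [Finite E] {F : Fragment X Y (Option (I → Bool)) E}
    {G : E → Fragment X Y (Option (I → Bool)) E'} {Q : E' → Store I Y → Prop} {σ : Store I Y}
    (h : F.WP w B (fun e σ' => (G e).WP w B Q σ') σ) : (F.bind G).WP w B Q σ := by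
  intro U hU
  obtain ⟨e, σ', U', hU', hr, hq⟩ := h U hU
  obtain ⟨e', σ'', U'', hU'', hr', hq'⟩ := hq U' hU'
  exact ⟨e', σ'', U'', hU'', runs_bind hr hr', hq'⟩

/-- The measure `μ` makes this a total correctness rule: it drops at every repetition, so the loop
is left. -/
theorem wp_iter [Finite A] {F : A → Fragment X Y (Option (I → Bool)) (A ⊕ E)}
    {Q : E → Store I Y → Prop} (Inv : A → Store I Y → Prop) (μ : A → Store I Y → ℕ)
    (step : ∀ a σ, Inv a σ → (F a).WP w B
      (fun r σ' => r.elim (fun a' => Inv a' σ' ∧ μ a' σ' < μ a σ) (fun e => Q e σ')) σ)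
    {a : A} {σ : Store I Y} (h : Inv a σ) : (iter F a).WP w B Q σ := by
  induction hn : μ a σ using Nat.strong_induction_on generalizing a σ with
  | _ n ih =>
    intro U hU
    obtain ⟨r, σ', U', hU', hr, hq⟩ := step a σ h U hU
    rcases r with a' | e
    · obtain ⟨e', σ'', U'', hU'', hr', hq'⟩ := ih _ (hn ▸ hq.2) hq.1 rfl U' hU'
      exact ⟨e', σ'', U'', hU'', runs_iter_next hr hr', hq'⟩
    · exact ⟨e, σ', U', hU', runs_iter_exit hr, hq⟩

/-- A single transition that leaves the work tape alone. -/
def control (t : InputSymbol X → HeadMove × List Y × E) :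
    Fragment X Y (Option (I → Bool)) E :=
  prim fun x g => ⟨(t x).2.2, g, (t x).1, .stay, (t x).2.1⟩

theorem wp_control {t : InputSymbol X → HeadMove × List Y × E} {Q : E → Store I Y → Prop}
    {σ : Store I Y} {m : HeadMove} {v : List Y} {e : E}
    (ht : t (inputSymbolAt w σ.inputHead) = (m, v, e))
    (h : Q e ⟨min (m.apply σ.inputHead) (w.length + 1), σ.reg, σ.output ++ v⟩) :
    (control t).WP w B Q σ := by
  intro U hU
  refine ⟨e, ⟨min (m.apply σ.inputHead) (w.length + 1), σ.reg, σ.output ++ v⟩, U,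
    ⟨min_le_right _ _, hU.le_bound, hU.lt_two_pow⟩, ?_, h⟩
  refine runs_prim _ (Nat.succ_pos _) ⟨e, (σ.memory U).work 0, m, .stay, v⟩ ?_ rfl ?_
  · simp [ht, Store.memory]
  · simp [Memory.apply, Store.memory, HeadMove.apply]

/-- Apply the Mealy machine `f` with initial state `a` to the columns of the work tape from left to
right, append the column `ext b` if the final state `b` demands it, bring the work head back, and
leave through the exit `b`. -/
def sweep [Finite A] (f : A → (I → Bool) → (I → Bool) × A) (ext : A → Option (I → Bool)) (a : A) :
    Fragment X Y (Option (I → Bool)) A :=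
  bind (prim fun _ g => ⟨(), g, .stay, .right, []⟩) fun _ =>
  bind (iter (fun a => prim fun _ g => g.elim ⟨.inr a, ext a, .stay, .left, []⟩
    fun col => ⟨.inl (f a col).2, some (f a col).1, .stay, .right, []⟩) a) fun a =>
  iter (fun a => prim fun _ g => g.elim ⟨.inr a, none, .stay, .stay, []⟩
    fun col => ⟨.inl a, some col, .stay, .left, []⟩) a

/-- The blank square `0` serves as the marker at which the returning head stops. -/
theorem runs_sweep_back [Finite A] {a : A} {col : ℕ → I → Bool} {U S i h : ℕ} {v : List Y}
    (hn : h ≤ w.length + 1) (hi : i ≤ U) (hS : U < S) :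
    (iter (fun a => (prim fun _ g => g.elim ⟨.inr a, none, .stay, .stay, []⟩
      fun col => ⟨.inl a, some col, .stay, .left, []⟩ :
        Fragment X Y (Option (I → Bool)) (A ⊕ A))) a).Runs w S
      ⟨h, columns col U, i, v⟩ a ⟨h, columns col U, 0, v⟩ := by
  induction i with
  | zero =>
    refine runs_iter_exit (runs_prim _ (by simp; omega) _ rfl rfl ?_)
    simp [Memory.apply, columns, HeadMove.apply, hn]
  | succ i ih =>
    have hg : columns col U (i + 1) = some (col i) := by simp [columns]; omega
    refine runs_iter_next (runs_prim _ (by simp; omega)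
      ⟨.inl a, some (col i), .stay, .left, []⟩ (by simp [hg]) rfl ?_) (ih (by omega))
    simp only [Memory.apply, HeadMove.apply, ← hg, Function.update_eq_self]
    simp [hn]

theorem update_columns (col col' : ℕ → I → Bool) {U i : ℕ} (hi : i < U) :
    Function.update (columns (fun k => if k < i then col' k else col k) U) (i + 1)
      (some (col' i)) = columns (fun k => if k < i + 1 then col' k else col k) U := by
  funext k
  rcases k with _ | k
  · simp [columns, Function.update]
  · rcases lt_trichotomy k i with h | rfl | h
    · simp [columns, Function.update, h.ne, h, h.trans (Nat.lt_succ_self i)]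
    · simp [columns, hi]
    · simp [columns, Function.update, h.ne', h.not_gt, show ¬ k < i + 1 by omega]

/-- In the middle of the sweep the columns before `i` are new and the others old. Column `i` lies on
square `i + 1`, and the first blank square `U + 1` ends the sweep. -/
theorem runs_sweep_forth [Finite A] {f : A → (I → Bool) → (I → Bool) × A}
    {ext : A → Option (I → Bool)} {col col' : ℕ → I → Bool} {st : ℕ → A} {U S i h : ℕ}
    {v : List Y} {s : Memory Y (Option (I → Bool))}
    (hst : ∀ i, f (st i) (col i) = (col' i, st (i + 1))) (hn : h ≤ w.length + 1) (hS : U + 1 < S)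
    (hs : s = ⟨h, Function.update (columns col' U) (U + 1) (ext (st U)), U, v⟩) (hi : i ≤ U) :
    (iter (fun a => (prim fun _ g => g.elim ⟨.inr a, ext a, .stay, .left, []⟩
      fun col => ⟨.inl (f a col).2, some (f a col).1, .stay, .right, []⟩ :
        Fragment X Y (Option (I → Bool)) (A ⊕ A))) (st i)).Runs w S
      ⟨h, columns (fun k => if k < i then col' k else col k) U, i + 1, v⟩ (st U) s := by
  induction hd : U - i generalizing i with
  | zero =>
    obtain rfl : i = U := by omega
    have hcol : columns (fun k => if k < i then col' k else col k) i = columns col' i := by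
      funext k
      rcases k with _ | k
      · rfl
      · by_cases hk : k < i <;> simp [columns, hk]
    refine runs_iter_exit (runs_prim _ (by simpa using hS)
      ⟨.inr (st i), ext (st i), .stay, .left, []⟩ (by simp [columns]) rfl ?_)
    simp [Memory.apply, HeadMove.apply, hn, hs, hcol]
  | succ d ih =>
    refine runs_iter_next (runs_prim _ (by simp; omega)
      ⟨.inl (st (i + 1)), some (col' i), .stay, .right, []⟩
      (by simp [columns, show i < U by omega, hst]) rfl ?_) (ih (i := i + 1) (by omega) (by omega))
    simp only [Memory.apply, HeadMove.apply, update_columns col col' (show i < U by omega)]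
    simp [hn]

/-- Rule for `sweep`: the states of the Mealy machine are `st 0, st 1, …`, and `R'` is the new
content of the registers. -/
theorem wp_sweep [Finite A] {f : A → (I → Bool) → (I → Bool) × A} {ext : A → Option (I → Bool)}
    {a : A} {Q : A → Store I Y → Prop} {σ : Store I Y} (st : ℕ → A) (R' : I → ℕ) (h0 : st 0 = a)
    (hst : ∀ i, f (st i) (digits σ.reg i) = (digits R' i, st (i + 1)))
    (hext : ∀ U, (∀ r, σ.reg r < 2 ^ U) →
      (ext (st U) = none ∧ ∀ r, R' r < 2 ^ U) ∨
      (ext (st U) = some (digits R' U) ∧ (∃ r, 2 ^ U ≤ R' r) ∧ ∀ r, R' r < 2 ^ (U + 1)))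
    (hB : (∀ r, σ.reg r < 2 ^ B) → ∀ r, R' r < 2 ^ B)
    (hQ : ∀ U, (∀ r, σ.reg r < 2 ^ U) → Q (st U) ⟨σ.inputHead, R', σ.output⟩) :
    (sweep f ext a).WP w B Q σ := by
  subst h0
  intro U hU
  have run : ∀ U', U ≤ U' → U' ≤ U + 1 →  U' ≤ B →
      Function.update (columns (digits R') U) (U + 1) (ext (st U)) = columns (digits R') U' →
      (sweep f ext (st 0)).Runs w (B + 2) (σ.memory U) (st U)
        (Store.memory ⟨σ.inputHead, R', σ.output⟩ U') := by
    intro U' h1 h2 h3 h4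
    refine runs_bind (s' := ⟨σ.inputHead, columns (digits σ.reg) U, 1, σ.output⟩)
      (runs_prim _ (Nat.succ_pos _) ⟨(), none, .stay, .right, []⟩ rfl rfl ?_)
      (runs_bind (runs_sweep_forth (i := 0) (U := U) hst hU.inputHead_le
        (by have := hU.le_bound; omega) rfl (Nat.zero_le U)) ?_)
    · simp only [Memory.apply, Store.memory, HeadMove.apply, min_eq_left hU.inputHead_le,
        List.append_nil, Memory.mk.injEq, true_and, and_true]
      exact Function.update_eq_self _ _
    · rw [h4]
      exact runs_sweep_back hU.inputHead_le h1 (by omega)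
  rcases hext U hU.lt_two_pow with ⟨hn, hR⟩ | ⟨hs, ⟨r, hr⟩, hR⟩
  · refine ⟨_, ⟨σ.inputHead, R', σ.output⟩, U, ⟨hU.inputHead_le, hU.le_bound, hR⟩,
      run U le_rfl (Nat.le_succ U) hU.le_bound ?_, hQ U hU.lt_two_pow⟩
    rw [hn, Function.update_eq_self_iff]
    simp [columns]
  -- A column is appended only when some register has reached `2 ^ U`; as all registers stay below
  -- `2 ^ B`, there is still room.
  · have hUB : U < B := (Nat.pow_lt_pow_iff_right Nat.one_lt_two).1 (hr.trans_lt
      (hB (fun r => (hU.lt_two_pow r).trans_le (Nat.pow_le_pow_right two_pos hU.le_bound)) r))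
    refine ⟨_, ⟨σ.inputHead, R', σ.output⟩, U + 1, ⟨hU.inputHead_le, hUB, hR⟩,
      run (U + 1) (Nat.le_succ U) le_rfl hUB ?_, hQ U hU.lt_two_pow⟩
    rw [hs]
    funext k
    rcases k with _ | k
    · simp [columns]
    · rcases lt_trichotomy k U with h | rfl | h
      · simp [columns, Function.update, h.ne, h, h.trans (Nat.lt_succ_self U)]
      · simp [columns]
      · simp [columns, Function.update, h.ne', h.not_gt, show ¬ k < U + 1 by omega]

/-- The transducer of a fragment whose run on the store with empty registers succeeds. -/
theorem outputs_of_wp [Finite I] [Finite X] [Finite Y] {F : Fragment X Y (Option (I → Bool)) E}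
    {v : List Y} (h : F.WP w B (fun _ σ' => σ'.output = v) ⟨1, fun _ => 0, []⟩) :
    (F.toTransducer none).Outputs w v ∧ (F.toTransducer none).UsesSpaceAtMost w (B + 2) := by
  -- Registers that hold zero need no digits, so the blank tape is a store with `U = 0`.
  obtain ⟨e, σ', U', -, hr, rfl⟩ := h 0 ⟨by simp, Nat.zero_le B, by simp⟩
  obtain ⟨h1, h2⟩ := reaches_of_runsFrom (none : Option (I → Bool)) (Nat.succ_pos (B + 1)) hr
  have hinit : (F.toTransducer none).init = F.config none (some F.entry)
      (Store.memory ⟨1, fun _ => 0, []⟩ 0) := by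
    have hw : columns (digits fun _ : I => 0) 0 = fun _ => none := by
      funext k
      rcases k with _ | k <;> simp [columns]
    simp only [config, Store.memory, hw]
    rfl
  rw [← hinit] at h1 h2
  exact ⟨⟨_, h1, rfl, rfl⟩, h2⟩

end Fragment

/-! ### Binary addition, subtraction and comparison, digit by digit -/

/-- The carry into digit `k` when the binary numbers `x`, `y` and the carry `c` are added. -/
def addCarry (x y : ℕ) (c : Bool) (k : ℕ) : Bool := decide (2 ^ k ≤ x % 2 ^ k + y % 2 ^ k + c.toNat)

theorem mod_two_pow_succ_eq (x k : ℕ) :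
    x % 2 ^ (k + 1) = x % 2 ^ k + (x.testBit k).toNat * 2 ^ k := by
  rw [Nat.pow_succ, Nat.mod_mul, Nat.toNat_testBit, Nat.mul_comm]

theorem testBit_eq_decide_le (x k : ℕ) : x.testBit k = decide (2 ^ k ≤ x % 2 ^ (k + 1)) := by
  have h1 := mod_two_pow_succ_eq x k
  have h2 := Nat.mod_lt x (Nat.two_pow_pos k)
  cases hb : x.testBit k <;> simp [hb] at h1 <;> simp <;> omega

@[simp]
theorem addCarry_zero (x y : ℕ) (c : Bool) : addCarry x y c 0 = c := by
  cases c <;> simp [addCarry, Nat.mod_one]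

theorem testBit_add_add (x y : ℕ) (c : Bool) (k : ℕ) :
    (x + y + c.toNat).testBit k = (x.testBit k ^^ (y.testBit k ^^ addCarry x y c k)) := by
  have hx := mod_two_pow_succ_eq x k
  have hy := mod_two_pow_succ_eq y k
  have hx' := Nat.mod_lt x (Nat.two_pow_pos k)
  have hy' := Nat.mod_lt y (Nat.two_pow_pos k)
  have hp : 2 ^ (k + 1) = 2 * 2 ^ k := Nat.pow_succ'
  have hc : c.toNat ≤ 1 := Bool.toNat_le c
  have hs : (x + y + c.toNat) % 2 ^ (k + 1) =
      (x % 2 ^ (k + 1) + y % 2 ^ (k + 1) + c.toNat) % 2 ^ (k + 1) := by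
    simp [Nat.add_mod]
  rw [testBit_eq_decide_le, hs, hx, hy, hp, addCarry]
  generalize 2 ^ k = p at *
  generalize c.toNat = d at *
  generalize x % p = a at *
  generalize y % p = b at *
  -- The sum of the residues and the carry is below `4 * p`, so reduction modulo `2 * p` subtracts
  -- `2 * p` at most once; what remains is linear.
  by_cases hab : p ≤ a + b + d <;> cases x.testBit k <;> cases y.testBit k <;> simp [hab]
  · rw [Nat.mod_eq_of_lt] <;> omega
  · rw [Nat.mod_eq_sub_mod, Nat.mod_eq_of_lt] <;> omega
  · rw [Nat.mod_eq_sub_mod, Nat.mod_eq_of_lt] <;> omega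
  · rw [Nat.mod_eq_sub_mod, Nat.mod_eq_of_lt] <;> omega
  · rw [Nat.mod_eq_of_lt] <;> omega
  · rw [Nat.mod_eq_of_lt] <;> omega
  · rw [Nat.mod_eq_of_lt] <;> omega
  · rw [Nat.mod_eq_sub_mod, Nat.mod_eq_of_lt] <;> omega

theorem addCarry_succ (x y : ℕ) (c : Bool) (k : ℕ) :
    addCarry x y c (k + 1) = ((x.testBit k && y.testBit k) ||
      (addCarry x y c k && (x.testBit k ^^ y.testBit k))) := by
  have hx := mod_two_pow_succ_eq x k
  have hy := mod_two_pow_succ_eq y k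
  have hx' := Nat.mod_lt x (Nat.two_pow_pos k)
  have hy' := Nat.mod_lt y (Nat.two_pow_pos k)
  have hp : 2 ^ (k + 1) = 2 * 2 ^ k := Nat.pow_succ'
  have hc : c.toNat ≤ 1 := Bool.toNat_le c
  rw [addCarry, hx, hy, hp, addCarry]
  generalize 2 ^ k = p at *
  generalize c.toNat = d at *
  generalize x % p = a at *
  generalize y % p = b at *
  by_cases hab : p ≤ a + b + d <;> cases x.testBit k <;> cases y.testBit k <;> simp [hab] <;> omega

theorem addCarry_eq_of_lt {x y U : ℕ} (c : Bool) (hx : x < 2 ^ U) (hy : y < 2 ^ U) :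
    addCarry x y c U = decide (2 ^ U ≤ x + y + c.toNat) := by
  rw [addCarry, Nat.mod_eq_of_lt hx, Nat.mod_eq_of_lt hy]

/-- The highest digit in which two numbers differ decides their order. Reading from the least
significant digit on, each new disagreement overrides the earlier verdict. -/
theorem mod_two_pow_succ_le_iff (x y k : ℕ) : decide (x % 2 ^ (k + 1) ≤ y % 2 ^ (k + 1)) =
    if x.testBit k = y.testBit k then decide (x % 2 ^ k ≤ y % 2 ^ k) else y.testBit k := by
  have hx := mod_two_pow_succ_eq x k
  have hy := mod_two_pow_succ_eq y k
  have hx' := Nat.mod_lt x (Nat.two_pow_pos k)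
  have hy' := Nat.mod_lt y (Nat.two_pow_pos k)
  rw [hx, hy]
  cases x.testBit k <;> cases y.testBit k <;> simp <;> omega

/-- Change the content of one register. -/
def Store.set {I Y : Type} [DecidableEq I] (σ : Store I Y) (r : I) (n : ℕ) : Store I Y :=
  ⟨σ.inputHead, Function.update σ.reg r n, σ.output⟩

@[simp]
theorem Store.set_inputHead {I Y : Type} [DecidableEq I] (σ : Store I Y) (r : I) (n : ℕ) :
    (σ.set r n).inputHead = σ.inputHead := rfl

@[simp]
theorem Store.set_output {I Y : Type} [DecidableEq I] (σ : Store I Y) (r : I) (n : ℕ) :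
    (σ.set r n).output = σ.output := rfl

@[simp]
theorem Store.set_reg {I Y : Type} [DecidableEq I] (σ : Store I Y) (r r' : I) (n : ℕ) :
    (σ.set r n).reg r' = if r' = r then n else σ.reg r' := by
  simp [Store.set, Function.update_apply]

/-- The content of a register, or zero. -/
def Store.value {I Y : Type} (σ : Store I Y) (o : Option I) : ℕ := o.elim 0 σ.reg

@[simp]
theorem Store.value_none {I Y : Type} (σ : Store I Y) : σ.value none = 0 := rfl

@[simp]
theorem Store.value_some {I Y : Type} (σ : Store I Y) (r : I) : σ.value (some r) = σ.reg r := rfl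

namespace Fragment

variable {I X Y E : Type} {w : List X} {B : ℕ}

/-- Do nothing. -/
def pure (e : E) : Fragment X Y (Option (I → Bool)) E := control fun _ => (.stay, [], e)

theorem wp_pure {e : E} {Q : E → Store I Y → Prop} {σ : Store I Y} (h : Q e σ) :
    (pure e : Fragment X Y (Option (I → Bool)) E).WP w B Q σ := by
  intro U hU
  have hσ : (⟨min (HeadMove.stay.apply σ.inputHead) (w.length + 1), σ.reg, σ.output ++ []⟩ :
      Store I Y) = σ := by
    simp [HeadMove.apply, hU.inputHead_le]
  exact wp_control rfl (by rwa [hσ]) U hU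

/-- Write a word to the output. -/
def writeOutput (v : List Y) : Fragment X Y (Option (I → Bool)) Unit :=
  control fun _ => (.stay, v, ())

theorem wp_writeOutput {v : List Y} {Q : Unit → Store I Y → Prop} {σ : Store I Y}
    (h : Q () ⟨min σ.inputHead (w.length + 1), σ.reg, σ.output ++ v⟩) :
    (writeOutput v : Fragment X Y (Option (I → Bool)) Unit).WP w B Q σ :=
  wp_control rfl h

theorem elim_digits (σ : Store I Y) (o : Option I) (i : ℕ) :
    o.elim false (digits σ.reg i) = (σ.value o).testBit i := by
  cases o <;> simp [digits, Store.value]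

theorem value_lt {σ : Store I Y} {U : ℕ} (h : ∀ r, σ.reg r < 2 ^ U) (o : Option I) :
    σ.value o < 2 ^ U := by
  cases o
  · simp
  · exact h _

theorem reg_mod_eq {σ : Store I Y} {U : ℕ} (h : ∀ r, σ.reg r < 2 ^ U) (r : I) :
    σ.reg r % 2 ^ U = σ.reg r := Nat.mod_eq_of_lt (h r)

/-- Compare two registers. -/
def le (r r' : I) : Fragment X Y (Option (I → Bool)) Bool :=
  sweep (fun b col => (col, if col r = col r' then b else col r')) (fun _ => none) true

theorem wp_le {r r' : I} {Q : Bool → Store I Y → Prop} {σ : Store I Y}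
    (hQ : Q (decide (σ.reg r ≤ σ.reg r')) σ) :
    (le r r' : Fragment X Y (Option (I → Bool)) Bool).WP w B Q σ := by
  refine wp_sweep (fun k => decide (σ.reg r % 2 ^ k ≤ σ.reg r' % 2 ^ k)) σ.reg
    (by simp [Nat.mod_one]) ?_ (fun U hU => .inl ⟨rfl, hU⟩) (fun h => h) fun U hU => ?_
  · intro i
    rw [mod_two_pow_succ_le_iff]
    rfl
  · rwa [reg_mod_eq hU, reg_mod_eq hU]

variable [DecidableEq I]

theorem update_digits (R : I → ℕ) (r : I) (n i : ℕ) :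
    Function.update (digits R i) r (n.testBit i) = digits (Function.update R r n) i := by
  funext r'
  by_cases h : r' = r <;> simp [digits, h]

theorem update_lt {R : I → ℕ} {r : I} {n b : ℕ} (h : ∀ r, R r < b) (hn : n < b) (r' : I) :
    Function.update R r n r' < b := by
  by_cases hr : r' = r <;> simp [hr, hn, h]

/-- Add the content of a register (or zero) and a carry to the register `r`. -/
def add (r : I) (o : Option I) (c : Bool) : Fragment X Y (Option (I → Bool)) Bool :=
  sweep (fun c col => (Function.update col r (col r ^^ (o.elim false col ^^ c)),
      (col r && o.elim false col) || (c && (col r ^^ o.elim false col))))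
    (fun c => if c then some (Function.update (fun _ => false) r true) else none) c

/-- The exit is the last carry. It depends on how many digits are in use on the tape, not only on
the store, so `Q` is demanded for both values. -/
theorem wp_add {r : I} {o : Option I} {c : Bool} {Q : Bool → Store I Y → Prop} {σ : Store I Y}
    (hB : σ.reg r + σ.value o + c.toNat < 2 ^ B)
    (hQ : ∀ b, Q b (σ.set r (σ.reg r + σ.value o + c.toNat))) :
    (add r o c : Fragment X Y (Option (I → Bool)) Bool).WP w B Q σ := by
  refine wp_sweep (addCarry (σ.reg r) (σ.value o) c) _ (addCarry_zero _ _ _) ?_ ?_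
    (fun h => update_lt h hB) fun U _ => hQ _
  · intro i
    have hr : digits σ.reg i r = (σ.reg r).testBit i := rfl
    rw [elim_digits, hr, ← testBit_add_add, update_digits, addCarry_succ]
  · intro U hU
    have hr := hU r
    have ho := value_lt hU o
    have hc : c.toNat ≤ 1 := Bool.toNat_le c
    have hp : 2 ^ (U + 1) = 2 * 2 ^ U := Nat.pow_succ'
    rw [addCarry_eq_of_lt c hr ho]
    by_cases h : 2 ^ U ≤ σ.reg r + σ.value o + c.toNat
    · refine .inr ⟨?_, ⟨r, by simpa using h⟩,
        update_lt (fun r => (hU r).trans_le (by omega)) (by omega)⟩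
      -- Before the addition all digits at place `U` are zero, so the appended column has a single
      -- one, the carry of `r`.
      have hz : digits σ.reg U = fun _ => false := by
        funext r
        exact Nat.testBit_lt_two_pow (hU r)
      have hb : (σ.reg r + σ.value o + c.toNat).testBit U = true := by
        rw [testBit_eq_decide_le, Nat.mod_eq_of_lt (by omega)]
        simpa using h
      rw [← update_digits, hz, hb]
      simp [h]
    · exact .inl ⟨by simpa using h, update_lt hU (by omega)⟩

/-- Subtract the content of the register `r'` from the register `r`. -/
def sub (r r' : I) : Fragment X Y (Option (I → Bool)) Bool :=
  sweep (fun c col => (Function.update col r (col r ^^ (col r' ^^ c)),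
      ((col r ^^ (col r' ^^ c)) && col r') || (c && ((col r ^^ (col r' ^^ c)) ^^ col r'))))
    (fun _ => none) false

/-- The borrows of the subtraction are the carries of the addition of the difference and the
subtrahend, so the rules for `addCarry` apply once the digit of the difference is solved for. -/
theorem wp_sub {r r' : I} {Q : Bool → Store I Y → Prop} {σ : Store I Y}
    (hr : σ.reg r' ≤ σ.reg r) (hQ : ∀ b, Q b (σ.set r (σ.reg r - σ.reg r'))) :
    (sub r r' : Fragment X Y (Option (I → Bool)) Bool).WP w B Q σ := by
  refine wp_sweep (addCarry (σ.reg r - σ.reg r') (σ.reg r') false) _ (addCarry_zero _ _ _) ?_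
    (fun U hU => .inl ⟨rfl, update_lt hU ((Nat.sub_le _ _).trans_lt (hU r))⟩)
    (fun h => update_lt h ((Nat.sub_le _ _).trans_lt (h r))) fun U _ => hQ _
  intro i
  have key := testBit_add_add (σ.reg r - σ.reg r') (σ.reg r') false i
  have hz : (σ.reg r - σ.reg r').testBit i = (digits σ.reg i r ^^ (digits σ.reg i r' ^^
      addCarry (σ.reg r - σ.reg r') (σ.reg r') false i)) := by
    rw [Bool.toNat_false, add_zero, Nat.sub_add_cancel hr] at key
    simp only [digits]
    rw [key]
    generalize (σ.reg r - σ.reg r').testBit i = a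
    generalize (σ.reg r').testBit i = b
    generalize addCarry (σ.reg r - σ.reg r') (σ.reg r') false i = c
    revert a b c
    decide
  rw [← hz, update_digits, addCarry_succ]
  rfl

/-- Copy the content of a register (or zero) to the register `r`. -/
def copy (r : I) (o : Option I) : Fragment X Y (Option (I → Bool)) Unit :=
  sweep (fun _ col => (Function.update col r (o.elim false col), ())) (fun _ => none) ()

theorem wp_copy {r : I} {o : Option I} {Q : Unit → Store I Y → Prop} {σ : Store I Y}
    (hQ : Q () (σ.set r (σ.value o))) :
    (copy r o : Fragment X Y (Option (I → Bool)) Unit).WP w B Q σ := by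
  refine wp_sweep (fun _ => ()) _ rfl ?_ (fun U hU => .inl ⟨rfl, update_lt hU (value_lt hU o)⟩)
    (fun h => update_lt h (value_lt h o)) fun U _ => hQ
  intro i
  rw [elim_digits, update_digits]

end Fragment

/-! ### Reflections and the growth of the largest coordinate -/

section Reflections

open Finset

/-- The reflection in the `x`-th simple root of a Coxeter system without relations between distinct
generators, with all off-diagonal entries of the bilinear form equal. -/
def reflect {X A : Type} [Fintype X] [DecidableEq X] [CommRing A] (x : X) (v : X → A) : X → A :=
  Function.update v x (3 * ∑ y ∈ univ.erase x, v y - v x)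

variable {X A : Type} [Fintype X] [DecidableEq X] [CommRing A]

theorem reflect_self (x : X) (v : X → A) :
    reflect x v x = 3 * ∑ y ∈ univ.erase x, v y - v x := by
  simp [reflect]

theorem reflect_of_ne {x y : X} (h : y ≠ x) (v : X → A) : reflect x v y = v y := by
  simp [reflect, h]

theorem sum_erase_reflect (x : X) (v : X → A) :
    ∑ y ∈ univ.erase x, reflect x v y = ∑ y ∈ univ.erase x, v y :=
  sum_congr rfl fun _ hy => reflect_of_ne (ne_of_mem_erase hy) v

@[simp]
theorem reflect_reflect (x : X) (v : X → A) : reflect x (reflect x v) = v := by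
  funext y
  by_cases h : y = x
  · subst h
    rw [reflect_self, sum_erase_reflect, reflect_self]
    ring
  · rw [reflect_of_ne h, reflect_of_ne h]

theorem reflect_intCast (x : X) (v : X → ℤ) :
    reflect x (fun y => (v y : A)) = fun y => ((reflect x v y : ℤ) : A) := by
  funext y
  by_cases h : y = x
  · subst h
    simp [reflect_self]
  · simp [reflect_of_ne h]

/-- All coordinates are positive, and the one at `y` is the unique largest one. -/
structure Dominates (v : X → ℤ) (y : X) : Prop where
  pos : ∀ z, 0 < v z
  lt : ∀ z, z ≠ y → v z < v y

/-- The new coordinate at `x` is at least `3 * v y - v x`, which exceeds `2 * v y` because `v x < v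
y`. -/
theorem Dominates.reflect {v : X → ℤ} {x y : X} (h : Dominates v y) (hxy : y ≠ x) :
    Dominates (reflect x v) x := by
  have hsum : v y ≤ ∑ z ∈ univ.erase x, v z :=
    single_le_sum (f := v) (fun z _ => (h.pos z).le) (mem_erase.2 ⟨hxy, mem_univ y⟩)
  have hx := h.lt x hxy.symm
  have hy := h.pos y
  have hself : v y < _root_.reflect x v x := by
    rw [reflect_self]
    linarith
  refine ⟨fun z => ?_, fun z hz => ?_⟩
  · by_cases hz : z = x
    · subst hz
      exact hy.trans hself
    · rw [reflect_of_ne hz]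
      exact h.pos z
  · rw [reflect_of_ne hz]
    refine lt_of_le_of_lt ?_ hself
    by_cases hzy : z = y
    · rw [hzy]
    · exact (h.lt z hzy).le

/-- Here the coefficient 3 matters: with 2 the all-ones vector would be fixed when `X` has two
elements, that is, in rank one. -/
theorem dominates_reflect_one {x y : X} (hxy : y ≠ x) : Dominates (reflect x (1 : X → ℤ)) x := by
  have hsum : (1 : X → ℤ) y ≤ ∑ z ∈ univ.erase x, (1 : X → ℤ) z :=
    single_le_sum (f := (1 : X → ℤ)) (fun z _ => zero_le_one) (mem_erase.2 ⟨hxy, mem_univ y⟩)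
  have hself : 1 < reflect x (1 : X → ℤ) x := by
    rw [reflect_self]
    simp only [Pi.one_apply] at hsum ⊢
    linarith
  refine ⟨fun z => ?_, fun z hz => ?_⟩
  · by_cases hz : z = x
    · subst hz
      exact zero_lt_one.trans hself
    · rw [reflect_of_ne hz]
      exact zero_lt_one
  · rw [reflect_of_ne hz]
    exact hself

theorem abs_reflect_le {v : X → ℤ} {b : ℤ} (h : ∀ y, |v y| ≤ b) (x y : X) :
    |reflect x v y| ≤ (3 * Fintype.card X + 1) * b := by
  have hb : 0 ≤ b := (abs_nonneg _).trans (h x)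
  by_cases hy : y = x
  · subst hy
    have hsum : |∑ z ∈ univ.erase y, v z| ≤ Fintype.card X * b := by
      refine (abs_sum_le_sum_abs _ _).trans ((sum_le_card_nsmul _ _ b fun z _ => h z).trans ?_)
      rw [nsmul_eq_mul]
      exact mul_le_mul_of_nonneg_right (by exact_mod_cast card_le_univ _) hb
    rw [reflect_self]
    have h1 := abs_le.1 hsum
    have h2 := abs_le.1 (h y)
    rw [abs_le]
    constructor <;> linarith
  · rw [reflect_of_ne hy]
    have : 0 ≤ (Fintype.card X : ℤ) * b := mul_nonneg (Int.natCast_nonneg _) hb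
    linarith [h y]

end Reflections

/-! ### The action of the free group and the stabilizer of the all-ones vector -/

section WordAction

theorem flip_ne {α : Type} (x : α × Bool) : (x.1, !x.2) ≠ x := fun h => by
  simpa using congrArg Prod.snd h

theorem flip_ne_of_isReduced_cons {α : Type} {x y : α × Bool} {u : List (α × Bool)}
    (hu : FreeGroup.IsReduced (x :: u)) (hy : y ∈ u.head?) : (x.1, !x.2) ≠ y := by
  rintro rfl
  cases u with
  | nil => simp at hy
  | cons a u =>
    obtain rfl : a = (x.1, !x.2) := by simpa using hy
    simpa using (List.isChain_cons_cons.1 hu).1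

variable {α A : Type} [Fintype α] [DecidableEq α] [CommRing A]

/-- A letter of the free group acts as a product of two reflections. -/
def letterAct (x : α × Bool) (v : α × Bool → A) : α × Bool → A :=
  reflect (x.1, !x.2) (reflect x v)

/-- The action of the letters of a word, from left to right. -/
def wordAct (u : List (α × Bool)) (v : α × Bool → A) : α × Bool → A :=
  u.foldl (fun v x => letterAct x v) v

@[simp]
theorem wordAct_nil (v : α × Bool → A) : wordAct [] v = v := rfl

@[simp]
theorem wordAct_cons (x : α × Bool) (u : List (α × Bool)) (v : α × Bool → A) :
    wordAct (x :: u) v = wordAct u (letterAct x v) := rfl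

@[simp]
theorem wordAct_append (u u' : List (α × Bool)) (v : α × Bool → A) :
    wordAct (u ++ u') v = wordAct u' (wordAct u v) := List.foldl_append

theorem wordAct_eq_of_red {u u' : List (α × Bool)} (h : FreeGroup.Red u u')
    (v : α × Bool → A) : wordAct u v = wordAct u' v := by
  induction h with
  | refl => rfl
  | tail _ h ih =>
    rw [ih]
    obtain ⟨⟩ := h
    simp [letterAct]

theorem wordAct_intCast (u : List (α × Bool)) (v : α × Bool → ℤ) :
    wordAct u (fun y => (v y : A)) = fun y => ((wordAct u v y : ℤ) : A) := by
  induction u generalizing v with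
  | nil => rfl
  | cons x u ih => rw [wordAct_cons, wordAct_cons, ← ih, letterAct, letterAct, reflect_intCast,
      reflect_intCast]

/-- A letter ends with the reflection in its inverse, and in a reduced word the next letter is not
that inverse. So each reflection is in a coordinate other than the dominating one. -/
theorem exists_dominates_wordAct {v : α × Bool → ℤ} {y : α × Bool} {u : List (α × Bool)}
    (hv : Dominates v y) (hu : FreeGroup.IsReduced u) (hy : ∀ x ∈ u.head?, y ≠ x) :
    ∃ z, Dominates (wordAct u v) z := by
  induction u generalizing v y with
  | nil => exact ⟨y, hv⟩
  | cons x u ih =>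
    refine ih ((hv.reflect (hy x rfl)).reflect (flip_ne x).symm)
      (List.IsChain.tail hu) fun _ => flip_ne_of_isReduced_cons hu

theorem wordAct_one_ne_of_isReduced {u : List (α × Bool)} (hu : FreeGroup.IsReduced u)
    (hne : u ≠ []) : wordAct u (1 : α × Bool → ℤ) ≠ 1 := by
  obtain ⟨x, u, rfl⟩ := List.exists_cons_of_ne_nil hne
  obtain ⟨z, hz⟩ : ∃ z, Dominates (wordAct (x :: u) 1) z := by
    rw [wordAct_cons]
    refine exists_dominates_wordAct (y := (x.1, !x.2))
      ((dominates_reflect_one (flip_ne x)).reflect (flip_ne x).symm)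
      (List.IsChain.tail hu) fun _ => flip_ne_of_isReduced_cons hu
  intro h
  have := hz.lt _ (flip_ne z)
  simp [h] at this

/-- The all-ones vector has trivial stabilizer. -/
theorem wordAct_one_eq_one_iff (u : List (α × Bool)) :
    wordAct u (1 : α × Bool → ℤ) = 1 ↔ FreeGroup.reduce u = [] := by
  rw [wordAct_eq_of_red FreeGroup.reduce.red]
  refine ⟨fun h => ?_, fun h => by rw [h, wordAct_nil]⟩
  by_contra hne
  exact wordAct_one_ne_of_isReduced (FreeGroup.IsReduced.of_reduce_eq FreeGroup.reduce.idem) hne h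

theorem abs_wordAct_one_le (u : List (α × Bool)) (y : α × Bool) :
    |wordAct u (1 : α × Bool → ℤ) y| ≤
      (((3 * Fintype.card (α × Bool) + 1) ^ 2 : ℕ) : ℤ) ^ u.length := by
  induction u using List.reverseRecOn generalizing y with
  | nil => simp
  | append_singleton u x ih =>
    rw [wordAct_append, wordAct_cons, wordAct_nil, letterAct, List.length_append,
      List.length_singleton, pow_succ']
    refine (abs_reflect_le (abs_reflect_le ih x) _ y).trans_eq ?_
    push_cast
    ring

end WordAction

/-! ### Detecting zero by small moduli -/

section Divisibility

/-- Each prime power that exactly divides the central binomial coefficient is at most `2 * N`, hence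
is one of the given divisors of `e`. -/
theorem centralBinom_dvd {N e : ℕ} (h : ∀ m, 1 < m → m ≤ 2 * N → m ∣ e) : N.centralBinom ∣ e := by
  rcases eq_or_ne e 0 with rfl | he
  · exact dvd_zero _
  rw [← Nat.factorization_prime_le_iff_dvd (Nat.centralBinom_ne_zero N) he]
  intro p hp
  rw [← hp.pow_dvd_iff_le_factorization he]
  rcases Nat.eq_zero_or_pos (N.centralBinom.factorization p) with h0 | h0
  · simp [h0]
  · refine h _ (Nat.one_lt_pow h0.ne' hp.one_lt) ?_
    have hN : 0 < 2 * N := by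
      rcases Nat.eq_zero_or_pos N with rfl | hN
      · simp at h0
      · omega
    exact Nat.pow_factorization_choose_le hN

theorem two_pow_le_centralBinom (N : ℕ) : 2 ^ N ≤ N.centralBinom := by
  induction N with
  | zero => simp
  | succ N ih =>
    have h := Nat.succ_mul_centralBinom_succ N
    have h2 : (N + 1) * (2 * N.centralBinom) ≤ (N + 1) * (N + 1).centralBinom := by
      rw [h]
      nlinarith [N.centralBinom_pos]
    have h3 := Nat.le_of_mul_le_mul_left h2 N.succ_pos
    rw [pow_succ]
    omega

theorem eq_zero_of_forall_dvd {N : ℕ} {e : ℤ} (h : ∀ m : ℕ, 1 < m → m ≤ 2 * N → (m : ℤ) ∣ e)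
    (he : |e| < 2 ^ N) : e = 0 := by
  have hd : N.centralBinom ∣ e.natAbs :=
    centralBinom_dvd fun m h1 h2 => Int.natCast_dvd.1 (h m h1 h2)
  by_contra hne
  have h1 := Nat.le_of_dvd (Int.natAbs_pos.2 hne) hd
  have h2 : (2 ^ N : ℤ) ≤ e.natAbs := by exact_mod_cast (two_pow_le_centralBinom N).trans h1
  rw [Int.natCast_natAbs] at h2
  omega

variable {α : Type} [Fintype α] [DecidableEq α]

/-- The moduli up to `modulusFactor α * n` suffice for the words of length at most `n`. -/
def modulusFactor (α : Type) [Fintype α] : ℕ := 2 * ((3 * Fintype.card (α × Bool) + 1) ^ 2 + 1)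

theorem reduce_eq_nil_of_forall_modulus {u : List (α × Bool)} {n : ℕ} (hu : u.length ≤ n)
    (hn : 0 < n) (h : ∀ m : ℕ, 1 < m → m ≤ modulusFactor α * n →
      wordAct u (1 : α × Bool → ZMod m) = 1) : FreeGroup.reduce u = [] := by
  rw [← wordAct_one_eq_one_iff]
  funext y
  rw [Pi.one_apply, ← sub_eq_zero]
  set K := (3 * Fintype.card (α × Bool) + 1) ^ 2 with hK
  -- As `K < 2 ^ K`, the coordinates are at most `2 ^ (K * n)`. The extra factor `2 ^ n` absorbs the
  -- subtracted 1.
  refine eq_zero_of_forall_dvd (N := (K + 1) * n) (fun m h1 h2 => ?_) ?_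
  · have h3 := congrFun (h m h1 (by rw [modulusFactor, mul_assoc, ← hK]; exact h2)) y
    have h4 := congrFun (wordAct_intCast (A := ZMod m) u 1) y
    have h5 : (fun y => ((1 : α × Bool → ℤ) y : ZMod m)) = 1 := by
      funext y
      simp
    rw [h5, h3] at h4
    rw [← ZMod.intCast_zmod_eq_zero_iff_dvd]
    push_cast
    rw [← h4]
    simp
  · have h1 := abs_wordAct_one_le u y
    rw [← hK] at h1
    have hK1 : 1 ≤ K := Nat.one_le_pow _ _ (Nat.succ_pos _)
    have h2 : K ^ u.length ≤ 2 ^ (K * n) := by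
      rw [pow_mul]
      exact (Nat.pow_le_pow_right hK1 hu).trans (Nat.pow_le_pow_left K.lt_two_pow_self.le n)
    have h3 : 2 * 2 ^ (K * n) ≤ 2 ^ ((K + 1) * n) := by
      rw [← pow_succ']
      exact Nat.pow_le_pow_right two_pos (by linarith)
    have h4 : 1 < 2 ^ (K * n) := Nat.one_lt_two_pow (by positivity)
    have h5 : |wordAct u (1 : α × Bool → ℤ) y - 1| ≤ (K : ℤ) ^ u.length + 1 :=
      (abs_sub _ _).trans (by simpa using h1)
    have h6 : K ^ u.length + 1 < 2 ^ ((K + 1) * n) := by omega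
    exact h5.trans_lt (by exact_mod_cast h6)

theorem wordAct_one_of_reduce_eq_nil {A : Type} [CommRing A] {u : List (α × Bool)}
    (hu : FreeGroup.reduce u = []) : wordAct u (1 : α × Bool → A) = 1 := by
  rw [wordAct_eq_of_red FreeGroup.reduce.red, hu, wordAct_nil]

end Divisibility

/-! ### Which letters survive free reduction -/

section Cancellation

open FreeGroup

variable {α : Type} [DecidableEq α]

theorem reduce_append_of_reduce_eq_nil {u v : List (α × Bool)} (h : reduce u = []) :
    reduce (u ++ v) = reduce v := by
  rw [← reduce_append_reduce_reduce, h, List.nil_append, reduce.idem]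

theorem reduce_cons_cases (x : α × Bool) (u : List (α × Bool)) :
    (∃ v, reduce u = (x.1, !x.2) :: v ∧ reduce (x :: u) = v) ∨ reduce (x :: u) = x :: reduce u := by
  rw [reduce.cons]
  cases reduce u with
  | nil => exact .inr rfl
  | cons y v =>
    by_cases h : x.1 = y.1 ∧ x.2 = !y.2
    · refine .inl ⟨v, ?_, by simp [h]⟩
      rw [h.1, h.2, Bool.not_not]
    · exact .inr (by simp only [if_neg h])

theorem mk_cons_flip_cons {α : Type} (x : α × Bool) (u : List (α × Bool)) :
    mk (x :: (x.1, !x.2) :: u) = mk u := Quot.sound Red.Step.cons_not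

theorem mk_cons_congr {α : Type} (x : α × Bool) {u v : List (α × Bool)} (h : mk u = mk v) :
    mk (x :: u) = mk (x :: v) := by
  rw [← List.singleton_append, ← mul_mk, h, mul_mk, List.singleton_append]

/-- Every prefix of the reduced form of a word is represented by a prefix of the word. -/
theorem exists_prefix_mk_eq (u : List (α × Bool)) {p : List (α × Bool)}
    (hp : p <+: reduce u) : ∃ v, v <+: u ∧ mk v = mk p := by
  induction u generalizing p with
  | nil => exact ⟨[], List.nil_prefix, by simp_all⟩
  | cons x u ih =>
    rcases reduce_cons_cases x u with ⟨v, hu, hv⟩ | h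
    -- Here `x` cancels against the first letter of `reduce u`. Restore that letter in front of `p`,
    -- find a prefix of `u` for the result, and put `x` before it.
    · rw [hv] at hp
      obtain ⟨t, ht, hm⟩ := ih (p := (x.1, !x.2) :: p) (by rwa [hu, List.prefix_cons_inj])
      exact ⟨x :: t, by rwa [List.prefix_cons_inj],
        (mk_cons_congr x hm).trans (mk_cons_flip_cons x p)⟩
    · rw [h, List.prefix_cons_iff] at hp
      rcases hp with rfl | ⟨p, rfl, hp⟩
      · exact ⟨[], List.nil_prefix, rfl⟩
      · obtain ⟨t, ht, hm⟩ := ih hp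
        exact ⟨x :: t, by rwa [List.prefix_cons_inj], mk_cons_congr x hm⟩

/-- If `x` cancelled, `reduce u` would start with its inverse. Some prefix of `u` would then
represent this inverse and, preceded by `x`, would be trivial. -/
theorem reduce_cons_of_forall_prefix {x : α × Bool} {u : List (α × Bool)}
    (h : ∀ v, v <+: u → reduce (x :: v) ≠ []) : reduce (x :: u) = x :: reduce u := by
  rcases reduce_cons_cases x u with ⟨v, hu, -⟩ | hx
  · obtain ⟨t, ht, hm⟩ := exists_prefix_mk_eq u (p := [(x.1, !x.2)]) (by simp [hu])
    refine absurd ?_ (h t ht)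
    rw [reduce.sound ((mk_cons_congr x hm).trans (mk_cons_flip_cons x [])), reduce_nil]
  · exact hx

end Cancellation

/-! ### The registers of the algorithm and access to the input -/

/-- The registers, apart from those that hold the coordinates of a vector. -/
inductive AuxRegister : Type where
  | accumulator
  | modulus
  | bound
  | start
  | finish
  | cursor
  | count
  | one
  deriving DecidableEq

instance : Fintype AuxRegister :=
  ⟨{.accumulator, .modulus, .bound, .start, .finish, .cursor, .count, .one}, fun r => by
    cases r <;> decide⟩

/-- The registers: one for each coordinate of a vector, and the auxiliary ones. -/
abbrev Register (α : Type) : Type := (α × Bool) ⊕ AuxRegister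

/-- Fragments of transducers over the letters of a free group, with the above registers. -/
abbrev RegisterFragment (α E : Type) : Type 1 :=
  Fragment (α × Bool) (α × Bool) (Option (Register α → Bool)) E

/-- Only the registers in `S` and the input head have changed. -/
structure Store.Frame {I Y : Type} (S : Set I) (σ σ' : Store I Y) : Prop where
  reg : ∀ r, r ∉ S → σ'.reg r = σ.reg r
  output : σ'.output = σ.output

theorem Store.Frame.refl {I Y : Type} (S : Set I) (σ : Store I Y) : Store.Frame S σ σ :=
  ⟨fun _ _ => rfl, rfl⟩

theorem Store.Frame.trans {I Y : Type} {S S' : Set I} {σ σ' σ'' : Store I Y}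
    (h : Store.Frame S σ σ') (h' : Store.Frame S' σ' σ'') (hS : S' ⊆ S) : Store.Frame S σ σ'' :=
  ⟨fun r hr => (h'.reg r fun hr' => hr (hS hr')).trans (h.reg r hr), h'.output.trans h.output⟩

theorem Store.Frame.set {I Y : Type} [DecidableEq I] {S : Set I} {σ σ' : Store I Y} {r : I}
    (h : Store.Frame S σ σ') (hr : r ∈ S) (n : ℕ) : Store.Frame S σ (σ'.set r n) :=
  ⟨fun r' hr' => by
    rw [Store.set_reg, if_neg (fun h : r' = r => hr' (h ▸ hr)), h.reg r' hr'], h.output⟩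

theorem Store.set_set {I Y : Type} [DecidableEq I] (σ : Store I Y) (r : I) (n n' : ℕ) :
    (σ.set r n).set r n' = σ.set r n' := by
  simp [Store.set]

namespace Fragment

section ReadAt

variable {α : Type} {w : List (α × Bool)} {B : ℕ}

/-- Move the input head to the left end marker. -/
def rewind : RegisterFragment α Unit :=
  iter (fun _ : Unit => control fun
    | .leftEnd => (.stay, [], .inr ())
    | _ => (.left, [], .inl ())) ()

theorem inputSymbolAt_succ (i : ℕ) :
    inputSymbolAt w (min (i + 1) (w.length + 1)) = (w[i]?).elim .rightEnd .letter := by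
  rcases lt_or_ge i w.length with h | h
  · rw [min_eq_left (by omega)]
    rfl
  · rw [min_eq_right (by omega)]
    simp [inputSymbolAt, h]

theorem wp_rewind {Q : Unit → Store (Register α) (α × Bool) → Prop}
    {σ : Store (Register α) (α × Bool)} (hQ : Q () ⟨0, σ.reg, σ.output⟩) :
    (rewind : RegisterFragment α Unit).WP w B Q σ := by
  refine wp_iter (fun _ σ' => σ'.reg = σ.reg ∧ σ'.output = σ.output)
    (fun _ σ' => σ'.inputHead) ?_ ⟨rfl, rfl⟩
  rintro - σ' ⟨hr, ho⟩
  obtain ⟨h, R, v⟩ := σ'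
  obtain rfl : R = σ.reg := hr
  obtain rfl : v = σ.output := ho
  rcases h with _ | h
  · refine wp_control rfl ?_
    simpa [HeadMove.apply] using hQ
  · refine wp_control (m := .left) (v := []) (e := .inl ()) ?_ ?_
    · cases hx : w[h]? <;> simp [inputSymbolAt, hx]
    · simp [HeadMove.apply]

variable [DecidableEq α]

/-- The letter at the position that is held by the cursor, if there is one. -/
def readAt [Finite α] : RegisterFragment α (Option (α × Bool)) :=
  rewind.bind fun _ => (copy (.inr .count) none).bind fun _ =>
  (iter (fun _ : Unit => (control fun _ => (.right, [], ())).bind fun _ : Unit =>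
    (le (.inr .cursor) (.inr .count)).bind fun b =>
      if b then pure (.inr ()) else
        (add (.inr .count) none true).bind fun _ => pure (.inl ())) ()).bind fun _ : Unit =>
  control fun
    | .letter x => (.stay, [], some x)
    | _ => (.stay, [], none)

theorem wp_readAt [Finite α] {Q : Option (α × Bool) → Store (Register α) (α × Bool) → Prop}
    {σ : Store (Register α) (α × Bool)} (hB : σ.reg (.inr .cursor) < 2 ^ B)
    (hQ : ∀ σ', Store.Frame {.inr .count} σ σ' → Q (w[σ.reg (.inr .cursor)]?) σ') :
    (readAt : RegisterFragment α _).WP w B Q σ := by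
  refine wp_bind (wp_rewind (wp_bind (wp_copy (wp_bind ?_))))
  -- The letter at position `i` is on square `i + 1`, and the head moves right before each
  -- comparison; so the loop is left on the square after the one numbered by the cursor. The minimum
  -- accounts for the head stopping at the right end marker.
  refine wp_iter (fun _ σ' => Store.Frame {.inr .count} σ σ' ∧
      σ'.inputHead = min (σ'.reg (.inr .count)) (w.length + 1) ∧
      σ'.reg (.inr .count) ≤ σ.reg (.inr .cursor))
    (fun _ σ' => σ.reg (.inr .cursor) - σ'.reg (.inr .count)) ?_ ?_
  · rintro - σ' ⟨hF, hh, hc⟩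
    have hcur := hF.reg (.inr .cursor) (by simp)
    refine wp_bind (wp_control rfl (wp_bind (wp_le ?_)))
    simp only [decide_eq_true_eq]
    split_ifs with h
    · refine wp_pure ?_
      rw [hcur] at h
      have hc' := hc.antisymm h
      have hs := inputSymbolAt_succ (w := w) (σ.reg (.inr .cursor))
      have hm : min (HeadMove.right.apply σ'.inputHead) (w.length + 1) =
          min (σ.reg (.inr .cursor) + 1) (w.length + 1) := by
        rw [hh, hc']
        simp only [HeadMove.apply]
        omega
      refine wp_control (m := .stay) (v := []) (e := w[σ.reg (.inr .cursor)]?) ?_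
        (hQ _ ⟨fun r hr => hF.reg r hr, by simpa using hF.output⟩)
      simp only [hm, hs]
      cases w[σ.reg (.inr .cursor)]? <;> rfl
    · rw [hcur] at h
      refine wp_bind (wp_add (by simp; omega) fun _ => wp_pure
        ⟨⟨⟨fun r hr => ?_, ?_⟩, ?_, ?_⟩, ?_⟩)
      · have hr' : r ≠ .inr .count := hr
        simp [hr', hF.reg r hr]
      · simpa using hF.output
      · simp [hh, HeadMove.apply]
      · simp
        omega
      · simp
        omega
  · refine ⟨⟨fun r hr => ?_, rfl⟩, by simp, by simp⟩
    have hr' : r ≠ .inr .count := hr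
    simp [hr']

end ReadAt

/-! ### Reflections modulo a number held in a register -/

section ModularArithmetic

variable {α : Type} [DecidableEq α] {w : List (α × Bool)} {B : ℕ}

/-- Add a coordinate to the accumulator, modulo the modulus. -/
def addMod (x : α × Bool) : RegisterFragment α Bool :=
  (add (.inr .accumulator) (some (.inl x)) false).bind fun _ =>
  (le (.inr .modulus) (.inr .accumulator)).bind fun b =>
    if b then sub (.inr .accumulator) (.inr .modulus) else pure false

theorem wp_addMod {x : α × Bool} {Q : Bool → Store (Register α) (α × Bool) → Prop}
    {σ : Store (Register α) (α × Bool)}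
    (hB : 2 * σ.reg (.inr .modulus) ≤ 2 ^ B)
    (ha : σ.reg (.inr .accumulator) < σ.reg (.inr .modulus))
    (hx : σ.reg (.inl x) < σ.reg (.inr .modulus))
    (hQ : ∀ b, Q b (σ.set (.inr .accumulator)
      ((σ.reg (.inr .accumulator) + σ.reg (.inl x)) % σ.reg (.inr .modulus)))) :
    (addMod x).WP w B Q σ := by
  refine wp_bind (wp_add (by simp; omega) fun _ => wp_bind (wp_le ?_))
  simp only [Store.set_reg, Store.value_some, decide_eq_true_eq, Bool.toNat_false, add_zero,
    reduceCtorEq, if_false, if_true, Sum.inr.injEq]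
  split_ifs with h
  · refine wp_sub (by simpa using h) fun b => ?_
    rw [Store.set_set]
    simp only [Store.set_reg, reduceCtorEq, if_false, if_true, Sum.inr.injEq]
    rw [Nat.mod_eq_sub_mod h, Nat.mod_eq_of_lt (by omega)] at hQ
    exact hQ b
  · rw [Nat.mod_eq_of_lt (by omega)] at hQ
    exact wp_pure (hQ _)

/-- Add three times each coordinate in a list to the accumulator, modulo the modulus. -/
def addAllMod : List (α × Bool) → RegisterFragment α Bool
  | [] => pure false
  | x :: l => (addMod x).bind fun _ => (addMod x).bind fun _ => (addMod x).bind fun _ =>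
      addAllMod l

theorem wp_addAllMod {l : List (α × Bool)} {Q : Bool → Store (Register α) (α × Bool) → Prop}
    {σ : Store (Register α) (α × Bool)}
    (hB : 2 * σ.reg (.inr .modulus) ≤ 2 ^ B)
    (ha : σ.reg (.inr .accumulator) < σ.reg (.inr .modulus))
    (hl : ∀ x ∈ l, σ.reg (.inl x) < σ.reg (.inr .modulus))
    (hQ : ∀ b, Q b (σ.set (.inr .accumulator) ((σ.reg (.inr .accumulator) +
      3 * (l.map fun x => σ.reg (.inl x)).sum) % σ.reg (.inr .modulus)))) :
    (addAllMod l).WP w B Q σ := by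
  induction l generalizing σ with
  | nil =>
    refine wp_pure ?_
    have := hQ false
    simp only [List.map_nil, List.sum_nil, mul_zero, add_zero, Nat.mod_eq_of_lt ha] at this
    have hσ : σ.set (.inr .accumulator) (σ.reg (.inr .accumulator)) = σ := by
      simp [Store.set]
    rwa [hσ] at this
  | cons x l ih =>
    have hx := hl x List.mem_cons_self
    have hm : 0 < σ.reg (.inr .modulus) := by omega
    refine wp_bind (wp_addMod hB ha hx fun _ => wp_bind (wp_addMod ?_ ?_ ?_ fun _ =>
      wp_bind (wp_addMod ?_ ?_ ?_ fun _ => ih ?_ ?_ ?_ fun b => ?_)))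
    · simpa using hB
    · simpa using Nat.mod_lt _ hm
    · simpa using hx
    · simpa using hB
    · simpa using Nat.mod_lt _ hm
    · simpa using hx
    · simpa using hB
    · simpa using Nat.mod_lt _ hm
    · intro y hy
      simpa using hl y (List.mem_cons_of_mem _ hy)
    · have := hQ b
      simp only [Store.set_set, Store.set_reg, reduceCtorEq, if_false, if_true, Sum.inr.injEq,
        Nat.mod_add_mod, List.map_cons, List.sum_cons] at this ⊢
      convert this using 3
      ring

variable [Fintype α]

/-- The vector that is stored modulo `m`. -/
def vector (m : ℕ) (σ : Store (Register α) (α × Bool)) : α × Bool → ZMod m :=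
  fun y => (σ.reg (.inl y) : ZMod m)

/-- Reflect the stored vector. -/
noncomputable def reflectVector (x : α × Bool) : RegisterFragment α Unit :=
  (copy (.inr .accumulator) none).bind fun _ =>
  (addAllMod (Finset.univ.erase x).toList).bind fun _ =>
  (le (.inl x) (.inr .accumulator)).bind fun b =>
  (if b then pure false else add (.inr .accumulator) (some (.inr .modulus)) false).bind fun _ =>
  (sub (.inr .accumulator) (.inl x)).bind fun _ =>
  copy (.inl x) (some (.inr .accumulator))

theorem wp_reflectVector {x : α × Bool} {Q : Unit → Store (Register α) (α × Bool) → Prop}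
    {σ : Store (Register α) (α × Bool)} {m : ℕ} (hm : σ.reg (.inr .modulus) = m)
    (hB : 2 * m ≤ 2 ^ B) (hv : ∀ y, σ.reg (.inl y) < m)
    (hQ : ∀ σ', Store.Frame (insert (.inr .accumulator) (Set.range .inl)) σ σ' →
      (∀ y, σ'.reg (.inl y) < m) → vector m σ' = reflect x (vector m σ) → Q () σ') :
    (reflectVector x).WP w B Q σ := by
  subst hm
  have hx := hv x
  have hm : 0 < σ.reg (.inr .modulus) := by omega
  refine wp_bind (wp_copy (wp_bind (wp_addAllMod ?_ ?_ ?_ fun _ => wp_bind (wp_le ?_))))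
  · simpa using hB
  · simpa using hm
  · intro y _
    simpa using hv y
  simp only [Store.set_set, Store.set_reg, Store.value_none, reduceCtorEq, if_false, if_true,
    Sum.inr.injEq, decide_eq_true_eq, zero_add]
  set a := 3 * ((Finset.univ.erase x).toList.map fun y => σ.reg (.inl y)).sum with ha
  have ham := Nat.mod_lt a hm
  -- Both branches produce the residue of `a` minus the old coordinate; the modulus is added first
  -- when the difference would be negative.
  have fin : ∀ r : ℕ, r < σ.reg (.inr .modulus) →
      (r : ZMod (σ.reg (.inr .modulus))) = a - σ.reg (.inl x) →
      Q () ((σ.set (.inr .accumulator) r).set (.inl x) r) := by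
    intro r hr hra
    refine hQ _ (((Store.Frame.refl _ _).set (by simp) _).set (by simp) _) (fun y => ?_) ?_
    · by_cases hy : y = x <;> simp [hy, hr, hv]
    · funext y
      by_cases hy : y = x
      · subst hy
        rw [reflect_self]
        simp only [vector, Store.set_reg, if_true, hra, ha]
        push_cast
        rw [← Finset.sum_map_toList, List.map_map]
        rfl
      · rw [reflect_of_ne hy]
        simp [vector, hy]
  split_ifs with h
  · refine wp_bind (wp_pure (wp_bind (wp_sub (by simpa using h) fun _ => wp_copy ?_)))
    simp only [Store.set_set, Store.set_reg, Store.value_some, reduceCtorEq, if_false, if_true]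
    refine fin _ (by omega) ?_
    rw [Nat.cast_sub h, ZMod.natCast_mod]
  · refine wp_bind (wp_add (by simp; omega) fun _ => wp_bind (wp_sub (by simp; omega) fun _ =>
      wp_copy ?_))
    simp only [Store.set_set, Store.set_reg, Store.value_some, reduceCtorEq, if_false, if_true,
      Bool.toNat_false, add_zero, Sum.inr.injEq]
    refine fin _ (by omega) ?_
    rw [Nat.cast_sub (by omega), Nat.cast_add, ZMod.natCast_mod, ZMod.natCast_self, add_zero]

end ModularArithmetic

end Fragment

theorem take_sub_succ_drop {X : Type} {w : List X} {i c : ℕ} (hic : i ≤ c) {x : X}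
    (hx : w[c]? = some x) :
    (w.drop i).take (c + 1 - i) = (w.drop i).take (c - i) ++ [x] := by
  rw [show c + 1 - i = c - i + 1 by omega, List.take_add_one, List.getElem?_drop,
    Nat.add_sub_cancel' hic, hx, Option.toList_some]

namespace Fragment

/-! ### The triviality test and the search for cancelling factors -/

section Test

variable {α : Type} [Fintype α] [DecidableEq α] {w : List (α × Bool)} {B : ℕ}

/-- Set the coordinates in a list to the content of the register `one`. -/
def setAll : List (α × Bool) → RegisterFragment α Unit
  | [] => pure ()
  | x :: l => (copy (.inl x) (some (.inr .one))).bind fun _ => setAll l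

omit [Fintype α] in
theorem wp_setAll {l : List (α × Bool)} {Q : Unit → Store (Register α) (α × Bool) → Prop}
    {σ : Store (Register α) (α × Bool)}
    (hQ : ∀ σ', Store.Frame (Set.range .inl) σ σ' →
      (∀ x, (x ∈ l ∨ σ.reg (.inl x) = σ.reg (.inr .one)) →
        σ'.reg (.inl x) = σ.reg (.inr .one)) → Q () σ') :
    (setAll l).WP w B Q σ := by
  induction l generalizing σ with
  | nil => exact wp_pure (hQ σ (.refl _ _) fun x hx => hx.resolve_left (by simp))
  | cons x l ih =>
    refine wp_bind (wp_copy (ih fun σ' hF h => ?_))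
    refine hQ σ' (((Store.Frame.refl _ _).set (by simp) _).trans hF subset_rfl) fun y hy => ?_
    have := h y
    simp only [Store.set_reg, Store.value_some, reduceCtorEq, if_false, Sum.inl.injEq] at this
    refine this ?_
    rw [List.mem_cons] at hy
    by_cases hyx : y = x <;> simp_all

/-- Do the coordinates in a list agree with the content of the register `one`? -/
def testAll : List (α × Bool) → RegisterFragment α Bool
  | [] => pure true
  | x :: l => (le (.inl x) (.inr .one)).bind fun b =>
    if b then (le (.inr .one) (.inl x)).bind fun b => if b then testAll l else pure false
    else pure false

omit [Fintype α] [DecidableEq α] in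
theorem wp_testAll {l : List (α × Bool)} {Q : Bool → Store (Register α) (α × Bool) → Prop}
    {σ : Store (Register α) (α × Bool)}
    (hQ : ∀ b, (b = true ↔ ∀ x ∈ l, σ.reg (.inl x) = σ.reg (.inr .one)) → Q b σ) :
    (testAll l).WP w B Q σ := by
  induction l with
  | nil => exact wp_pure (hQ true (by simp))
  | cons x l ih =>
    refine wp_bind (wp_le ?_)
    simp only [decide_eq_true_eq]
    split_ifs with h
    · refine wp_bind (wp_le ?_)
      simp only [decide_eq_true_eq]
      split_ifs with h'
      · refine ih fun b hb => hQ b ?_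
        rw [hb, List.forall_mem_cons]
        exact ⟨fun hl => ⟨h.antisymm h', hl⟩, fun hl => hl.2⟩
      · refine wp_pure (hQ false ?_)
        rw [List.forall_mem_cons]
        simp only [Bool.false_eq_true, false_iff, not_and]
        intro h''
        exact absurd h''.ge h'
    · refine wp_pure (hQ false ?_)
      rw [List.forall_mem_cons]
      simp only [Bool.false_eq_true, false_iff, not_and]
      intro h''
      exact absurd h''.le h

/-- The registers that are changed by the test for one modulus. -/
def testRegisters (α : Type) : Set (Register α) :=
  {.inr .accumulator, .inr .cursor, .inr .count, .inr .one} ∪ Set.range .inl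

/-- Apply the letters between the positions `start` and `finish` to the stored vector. -/
noncomputable def applyLetters : RegisterFragment α Unit :=
  (copy (.inr .cursor) (some (.inr .start))).bind fun _ =>
  iter (fun _ : Unit => (le (.inr .finish) (.inr .cursor)).bind fun b =>
    if b then pure (.inr ()) else readAt.bind fun
      | none => pure (.inr ())
      | some x => (reflectVector x).bind fun _ => (reflectVector (x.1, !x.2)).bind fun _ =>
        (add (.inr .cursor) none true).bind fun _ => pure (.inl ())) ()

theorem wp_applyLetters {Q : Unit → Store (Register α) (α × Bool) → Prop}
    {σ : Store (Register α) (α × Bool)} {i j m : ℕ} (hi : σ.reg (.inr .start) = i)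
    (hj : σ.reg (.inr .finish) = j) (hm : σ.reg (.inr .modulus) = m) (hij : i ≤ j)
    (hjw : j ≤ w.length) (hwB : w.length < 2 ^ B) (hmB : 2 * m ≤ 2 ^ B)
    (hv : ∀ y, σ.reg (.inl y) < m)
    (hQ : ∀ σ', Store.Frame
        ({.inr .accumulator, .inr .cursor, .inr .count} ∪ Set.range .inl) σ σ' →
      (∀ y, σ'.reg (.inl y) < m) →
      vector m σ' = wordAct ((w.drop i).take (j - i)) (vector m σ) → Q () σ') :
    (applyLetters : RegisterFragment α Unit).WP w B Q σ := by
  refine wp_bind (wp_copy ?_)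
  refine wp_iter (fun _ σ' =>
      Store.Frame ({.inr .accumulator, .inr .cursor, .inr .count} ∪ Set.range .inl) σ σ' ∧
      (∀ y, σ'.reg (.inl y) < m) ∧ i ≤ σ'.reg (.inr .cursor) ∧ σ'.reg (.inr .cursor) ≤ j ∧
      vector m σ' = wordAct ((w.drop i).take (σ'.reg (.inr .cursor) - i)) (vector m σ))
    (fun _ σ' => j - σ'.reg (.inr .cursor)) ?_ ?_
  · rintro - σ₁ ⟨hF, hv₁, hic, hcj, hvec⟩
    refine wp_bind (wp_le ?_)
    rw [hF.reg (.inr .finish) (by simp), hj]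
    simp only [decide_eq_true_eq]
    split_ifs with h
    · refine wp_pure (hQ _ hF hv₁ ?_)
      rw [hvec, hcj.antisymm h]
    · refine wp_bind (wp_readAt (by omega) fun σ₂ hF₂ => ?_)
      have hlt : σ₁.reg (.inr .cursor) < w.length := by omega
      have hx := List.getElem?_eq_getElem hlt
      generalize w[σ₁.reg (.inr .cursor)] = x at hx
      rw [hx]
      have hv₂ : ∀ y, σ₂.reg (.inl y) = σ₁.reg (.inl y) := fun y => hF₂.reg _ (by simp)
      have hm₂ : σ₂.reg (.inr .modulus) = m := by
        rw [hF₂.reg _ (by simp), hF.reg _ (by simp), hm]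
      refine wp_bind (wp_reflectVector hm₂ hmB (fun y => (hv₂ y).trans_lt (hv₁ y))
        fun σ₃ hF₃ hv₃ hvec₃ => wp_bind (wp_reflectVector ?_ hmB hv₃
        fun σ₄ hF₄ hv₄ hvec₄ => ?_))
      · rw [hF₃.reg _ (by simp), hm₂]
      have hc₄ : σ₄.reg (.inr .cursor) = σ₁.reg (.inr .cursor) := by
        rw [hF₄.reg _ (by simp), hF₃.reg _ (by simp), hF₂.reg _ (by simp)]
      refine wp_bind (wp_add (by simp [hc₄]; omega) fun _ => wp_pure
        ⟨⟨Store.Frame.set ?_ (by simp) _, fun y => ?_, ?_, ?_, ?_⟩, ?_⟩)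
      · refine ((hF.trans hF₂ ?_).trans hF₃ ?_).trans hF₄ ?_ <;> intro r <;>
          simp only [Set.mem_union, Set.mem_insert_iff, Set.mem_singleton_iff] <;> tauto
      · simpa using hv₄ y
      · simp [hc₄]
        omega
      · simp [hc₄]
        omega
      · have hset : ∀ n, vector m (σ₄.set (.inr .cursor) n) = vector m σ₄ := fun n => by
          funext y
          simp [vector]
        have hvec₂ : vector m σ₂ = vector m σ₁ := by
          funext y
          simp [vector, hv₂]
        rw [hset, hvec₄, hvec₃, hvec₂, hvec]
        simp only [Store.set_reg, if_true, hc₄, Store.value_none, add_zero, Bool.toNat_true]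
        rw [take_sub_succ_drop hic hx, wordAct_append]
        rfl
      · simp [hc₄]
        omega
  · refine ⟨(Store.Frame.refl _ _).set (by simp) _, fun y => ?_, ?_, ?_, ?_⟩
    · simpa using hv y
    · simp [hi]
    · simp [hi, hij]
    · funext y
      simp [hi, vector]

/-- Does the word between the positions `start` and `finish` act trivially modulo the modulus? -/
noncomputable def testModulus : RegisterFragment α Bool :=
  (copy (.inr .one) none).bind fun _ => (add (.inr .one) none true).bind fun _ =>
  (setAll Finset.univ.toList).bind fun _ => applyLetters.bind fun _ => testAll Finset.univ.toList

theorem wp_testModulus {Q : Bool → Store (Register α) (α × Bool) → Prop}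
    {σ : Store (Register α) (α × Bool)} {i j m : ℕ} (hi : σ.reg (.inr .start) = i)
    (hj : σ.reg (.inr .finish) = j) (hm : σ.reg (.inr .modulus) = m) (hij : i ≤ j)
    (hjw : j ≤ w.length) (hwB : w.length < 2 ^ B) (hmB : 2 * m ≤ 2 ^ B) (hm1 : 1 < m)
    (hQ : ∀ b σ', Store.Frame (testRegisters α) σ σ' →
      (b = true ↔ wordAct ((w.drop i).take (j - i)) (1 : α × Bool → ZMod m) = 1) → Q b σ') :
    (testModulus : RegisterFragment α Bool).WP w B Q σ := by
  refine wp_bind (wp_copy (wp_bind (wp_add (by simp; rintro rfl; omega) fun _ => wp_bind (wp_setAll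
    fun σ₁ hF₁ h₁ => ?_))))
  have hF₁' : Store.Frame (testRegisters α) σ σ₁ := by
    refine Store.Frame.trans (((Store.Frame.refl _ _).set ?_ _).set ?_ _) hF₁ ?_
    · simp [testRegisters]
    · simp [testRegisters]
    · exact Set.subset_union_right
  simp only [Store.set_reg, if_true, Store.value_none, Bool.toNat_true, zero_add,
    Finset.mem_toList, Finset.mem_univ, true_or, forall_const] at h₁
  have hone : σ₁.reg (.inr .one) = 1 := by
    rw [hF₁.reg _ (by simp)]
    simp
  refine wp_bind (wp_applyLetters (i := i) (j := j) (m := m) ?_ ?_ ?_ hij hjw hwB hmB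
    (fun y => by rw [h₁ y]; exact hm1) fun σ₂ hF₂ hv₂ hvec₂ => wp_testAll fun b hb =>
    hQ b σ₂ (hF₁'.trans hF₂ ?_) ?_)
  · rw [hF₁'.reg _ (by simp [testRegisters]), hi]
  · rw [hF₁'.reg _ (by simp [testRegisters]), hj]
  · rw [hF₁'.reg _ (by simp [testRegisters]), hm]
  · intro r
    simp only [testRegisters, Set.mem_union, Set.mem_insert_iff, Set.mem_singleton_iff]
    tauto
  · have hvec₁ : vector m σ₁ = 1 := by
      funext y
      simp [vector, h₁ y]
    rw [hb, ← hvec₁, ← hvec₂, hvec₁, hF₂.reg (.inr .one) (by simp), hone, funext_iff]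
    simp only [Finset.mem_toList, Finset.mem_univ, forall_const, vector, Pi.one_apply]
    refine forall_congr' fun y => ⟨fun h => by rw [h, Nat.cast_one], fun h => ?_⟩
    -- The stored coordinate and 1 are both below `m`, so congruence is equality.
    rw [← Nat.cast_one, ZMod.natCast_eq_natCast_iff'] at h
    rwa [Nat.mod_eq_of_lt (hv₂ y), Nat.mod_eq_of_lt hm1] at h

/-- Add a multiple of `finish` to the register `bound`. -/
def addMultiple : ℕ → RegisterFragment α Unit
  | 0 => pure ()
  | n + 1 => (add (.inr .bound) (some (.inr .finish)) false).bind fun _ => addMultiple n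

omit [Fintype α] in
theorem wp_addMultiple {n : ℕ} {Q : Unit → Store (Register α) (α × Bool) → Prop}
    {σ : Store (Register α) (α × Bool)}
    (hB : σ.reg (.inr .bound) + n * σ.reg (.inr .finish) < 2 ^ B)
    (hQ : ∀ σ', Store.Frame {.inr .bound} σ σ' →
      σ'.reg (.inr .bound) = σ.reg (.inr .bound) + n * σ.reg (.inr .finish) → Q () σ') :
    (addMultiple n).WP w B Q σ := by
  induction n generalizing σ with
  | zero => exact wp_pure (hQ σ (.refl _ _) (by simp))
  | succ n ih =>
    rw [add_mul, one_mul] at hB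
    refine wp_bind (wp_add (by simp; omega) fun _ => ih (by simp; omega) fun σ' hF h => ?_)
    refine hQ σ' (((Store.Frame.refl _ _).set (by simp) _).trans hF subset_rfl) ?_
    rw [h]
    simp
    ring

/-- The registers that are changed by the triviality test. -/
def trivialityRegisters (α : Type) : Set (Register α) :=
  testRegisters α ∪ {.inr .bound, .inr .modulus}

/-- Does the word between the positions `start` and `finish` represent the identity? -/
noncomputable def testTrivial : RegisterFragment α Bool :=
  (copy (.inr .bound) none).bind fun _ => (addMultiple (modulusFactor α)).bind fun _ =>
  (copy (.inr .modulus) none).bind fun _ => (add (.inr .modulus) none true).bind fun _ =>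
  iter (fun _ : Unit => (le (.inr .bound) (.inr .modulus)).bind fun b =>
    if b then pure (.inr true) else (add (.inr .modulus) none true).bind fun _ =>
      testModulus.bind fun b => if b then pure (.inl ()) else pure (.inr false)) ()

theorem wp_testTrivial {Q : Bool → Store (Register α) (α × Bool) → Prop}
    {σ : Store (Register α) (α × Bool)} {i j : ℕ} (hi : σ.reg (.inr .start) = i)
    (hj : σ.reg (.inr .finish) = j) (hij : i < j) (hjw : j ≤ w.length)
    (hB : 2 * (modulusFactor α * w.length) + 1 < 2 ^ B)
    (hQ : ∀ b σ', Store.Frame (trivialityRegisters α) σ σ' →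
      (b = true ↔ FreeGroup.reduce ((w.drop i).take (j - i)) = []) → Q b σ') :
    (testTrivial : RegisterFragment α Bool).WP w B Q σ := by
  have hfac : 1 ≤ modulusFactor α := by
    unfold modulusFactor
    omega
  have hwB : w.length < 2 ^ B := by
    have := Nat.mul_le_mul_right w.length hfac
    omega
  have hjB : modulusFactor α * j ≤ modulusFactor α * w.length := Nat.mul_le_mul_left _ hjw
  refine wp_bind (wp_copy (wp_bind (wp_addMultiple (by simp [hj]; omega) fun σ₁ hF₁ h₁ => ?_)))
  simp only [Store.set_reg, if_true, Store.value_none, zero_add, reduceCtorEq, if_false,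
    Sum.inr.injEq, hj] at h₁
  refine wp_bind (wp_copy (wp_bind (wp_add (by simp; rintro rfl; omega) fun _ => ?_)))
  simp only [Store.set_set, Store.set_reg, Store.value_none, if_true, Bool.toNat_true, zero_add]
  have hF₁' : Store.Frame (trivialityRegisters α) σ (σ₁.set (.inr .modulus) 1) := by
    refine (Store.Frame.trans ((Store.Frame.refl _ _).set ?_ _) hF₁ ?_).set ?_ _
    all_goals simp [trivialityRegisters]
  refine wp_iter (fun _ σ' => Store.Frame (trivialityRegisters α) σ σ' ∧
      σ'.reg (.inr .bound) = modulusFactor α * j ∧ 1 ≤ σ'.reg (.inr .modulus) ∧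
      ∀ m : ℕ, 1 < m → m ≤ σ'.reg (.inr .modulus) →
        wordAct ((w.drop i).take (j - i)) (1 : α × Bool → ZMod m) = 1)
    (fun _ σ' => modulusFactor α * j - σ'.reg (.inr .modulus)) ?_ ?_
  · rintro - σ₂ ⟨hF₂, hb₂, hm₂, hw₂⟩
    refine wp_bind (wp_le ?_)
    rw [hb₂]
    simp only [decide_eq_true_eq]
    split_ifs with h
    · refine wp_pure (hQ true σ₂ hF₂ ⟨fun _ => ?_, fun _ => rfl⟩)
      -- The bound on the moduli is taken from `j`, not from the length `j - i`. This tests more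
      -- moduli than necessary but avoids a subtraction, and `j` is positive.
      refine reduce_eq_nil_of_forall_modulus (n := j) ?_ (by omega)
        fun m h1 h2 => hw₂ m h1 (h2.trans h)
      rw [List.length_take]
      omega
    · refine wp_bind (wp_add (by simp; omega) fun _ => wp_bind (wp_testModulus
        (i := i) (j := j) (m := σ₂.reg (.inr .modulus) + 1) ?_ ?_ ?_ hij.le hjw hwB
        (by omega) (by omega) fun b σ₃ hF₃ hb₃ => ?_))
      · simpa [hF₂.reg (.inr .start) (by simp [trivialityRegisters, testRegisters])] using hi
      · simpa [hF₂.reg (.inr .finish) (by simp [trivialityRegisters, testRegisters])] using hj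
      · simp
      have hF₃' : Store.Frame (trivialityRegisters α) σ σ₃ :=
        (hF₂.set (by simp [trivialityRegisters]) _).trans hF₃ Set.subset_union_left
      have hm₃ : σ₃.reg (.inr .modulus) = σ₂.reg (.inr .modulus) + 1 := by
        rw [hF₃.reg _ (by simp [testRegisters])]
        simp
      split_ifs with hb
      · refine wp_pure ⟨⟨hF₃', ?_, by omega, fun m h1 h2 => ?_⟩, by rw [hm₃]; omega⟩
        · rw [hF₃.reg _ (by simp [testRegisters])]
          simpa using hb₂
        · rw [hm₃] at h2
          rcases h2.eq_or_lt with rfl | h2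
          · exact hb₃.1 hb
          · exact hw₂ m h1 (by omega)
      · refine wp_pure (hQ false σ₃ hF₃' ⟨fun h => absurd h Bool.false_ne_true, fun h => ?_⟩)
        exact absurd (hb₃.2 (wordAct_one_of_reduce_eq_nil h)) hb
  -- The modulus starts at 1, where no modulus has been claimed yet; it is increased before each
  -- test.
  · refine ⟨hF₁', by simpa using h₁, by simp, fun m h1 h2 => ?_⟩
    simp at h2
    omega

/-- Search for a nonempty word from the position `start` on that represents the identity, and let
`finish` be its end. -/
noncomputable def searchTrivial : RegisterFragment α Bool :=
  (copy (.inr .finish) (some (.inr .start))).bind fun _ =>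
  iter (fun _ : Unit => (copy (.inr .cursor) (some (.inr .finish))).bind fun _ => readAt.bind fun
    | none => pure (.inr false)
    | some _ => (add (.inr .finish) none true).bind fun _ =>
      testTrivial.bind fun b => if b then pure (.inr true) else pure (.inl ())) ()

theorem wp_searchTrivial {Q : Bool → Store (Register α) (α × Bool) → Prop}
    {σ : Store (Register α) (α × Bool)} {i : ℕ} (hi : σ.reg (.inr .start) = i)
    (hiw : i ≤ w.length) (hB : 2 * (modulusFactor α * w.length) + 1 < 2 ^ B)
    (hT : ∀ σ', Store.Frame {.inr .start}ᶜ σ σ' → i < σ'.reg (.inr .finish) →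
      σ'.reg (.inr .finish) ≤ w.length →
      FreeGroup.reduce ((w.drop i).take (σ'.reg (.inr .finish) - i)) = [] → Q true σ')
    (hN : ∀ σ', Store.Frame {.inr .start}ᶜ σ σ' → (∀ j, i < j → j ≤ w.length →
      FreeGroup.reduce ((w.drop i).take (j - i)) ≠ []) → Q false σ') :
    (searchTrivial : RegisterFragment α Bool).WP w B Q σ := by
  have hwB : w.length < 2 ^ B := by
    have : 1 * w.length ≤ modulusFactor α * w.length :=
      Nat.mul_le_mul_right _ (by unfold modulusFactor; omega)
    omega
  refine wp_bind (wp_copy ?_)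
  refine wp_iter (fun _ σ' => Store.Frame {.inr .start}ᶜ σ σ' ∧ i ≤ σ'.reg (.inr .finish) ∧
      σ'.reg (.inr .finish) ≤ w.length ∧ ∀ j, i < j → j ≤ σ'.reg (.inr .finish) →
        FreeGroup.reduce ((w.drop i).take (j - i)) ≠ [])
    (fun _ σ' => w.length - σ'.reg (.inr .finish)) ?_ ?_
  · rintro - σ₁ ⟨hF₁, his, hsw, hred⟩
    refine wp_bind (wp_copy (wp_bind (wp_readAt (by simp; omega) fun σ₂ hF₂ => ?_)))
    have hF₂' : Store.Frame {.inr .start}ᶜ σ σ₂ :=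
      (hF₁.set (by simp) _).trans hF₂ (by simp)
    have hs₂ : σ₂.reg (.inr .finish) = σ₁.reg (.inr .finish) := by
      rw [hF₂.reg _ (by simp)]
      simp
    simp only [Store.set_reg, if_true, Store.value_some]
    -- At the end of the input every possible end of a factor has been refuted; otherwise the factor
    -- is lengthened by one letter and tested.
    rcases hsw.eq_or_lt with heq | hlt
    · rw [List.getElem?_eq_none heq.ge]
      exact wp_pure (hN σ₂ hF₂' (by rwa [heq] at hred))
    · rw [List.getElem?_eq_getElem hlt]
      refine wp_bind (wp_add (by simp; omega) fun _ => wp_bind (wp_testTrivial (i := i)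
        (j := σ₁.reg (.inr .finish) + 1) ?_ ?_ (by omega) hlt hB fun b σ₃ hF₃ hb₃ => ?_))
      · rw [← hi, Store.set_reg, if_neg (by simp), hF₂'.reg _ (by simp)]
      · simp [hs₂]
      have hF₃' : Store.Frame {.inr .start}ᶜ σ σ₃ := by
        refine (hF₂'.set (by simp) _).trans hF₃ fun r hr => ?_
        rintro rfl
        simp [trivialityRegisters, testRegisters] at hr
      have hs₃ : σ₃.reg (.inr .finish) = σ₁.reg (.inr .finish) + 1 := by
        rw [hF₃.reg _ (by simp [trivialityRegisters, testRegisters])]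
        simp [hs₂]
      split_ifs with hb
      · refine wp_pure (hT σ₃ hF₃' (by omega) (by omega) ?_)
        rw [hs₃]
        exact hb₃.1 hb
      · refine wp_pure ⟨⟨hF₃', by omega, by omega, fun j h1 h2 h3 => ?_⟩, by omega⟩
        rw [hs₃] at h2
        rcases h2.eq_or_lt with rfl | h2
        · exact hb (hb₃.2 h3)
        · exact hred j h1 (by omega) h3
  · refine ⟨(Store.Frame.refl _ _).set (by simp) _, by simp [hi], by simp [hi, hiw],
      fun j h1 h2 => ?_⟩
    simp [hi] at h2
    omega

/-- Write the reduced form of the input. -/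
noncomputable def writeReduced : RegisterFragment α Unit :=
  iter (fun _ : Unit => (copy (.inr .cursor) (some (.inr .start))).bind fun _ => readAt.bind fun
    | none => pure (.inr ())
    | some x => searchTrivial.bind fun b =>
      if b then (copy (.inr .start) (some (.inr .finish))).bind fun _ => pure (.inl ())
      else (writeOutput [x]).bind fun _ =>
        (add (.inr .start) none true).bind fun _ => pure (.inl ())) ()

theorem wp_writeReduced (hB : 2 * (modulusFactor α * w.length) + 1 < 2 ^ B) :
    (writeReduced : RegisterFragment α Unit).WP w B
      (fun _ σ' => σ'.output = FreeGroup.reduce w) ⟨1, fun _ => 0, []⟩ := by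
  have hwB : w.length < 2 ^ B := by
    have : 1 * w.length ≤ modulusFactor α * w.length :=
      Nat.mul_le_mul_right _ (by unfold modulusFactor; omega)
    omega
  -- The output followed by the reduced form of the unread suffix never changes. Both ways of
  -- continuing consume at least one letter.
  refine wp_iter (fun _ σ' => σ'.reg (.inr .start) ≤ w.length ∧
      σ'.output ++ FreeGroup.reduce (w.drop (σ'.reg (.inr .start))) = FreeGroup.reduce w)
    (fun _ σ' => w.length - σ'.reg (.inr .start)) ?_ (by simp)
  rintro - σ₁ ⟨hsw, hout⟩
  refine wp_bind (wp_copy (wp_bind (wp_readAt (by simp; omega) fun σ₂ hF₂ => ?_)))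
  have hs₂ : σ₂.reg (.inr .start) = σ₁.reg (.inr .start) := by
    rw [hF₂.reg _ (by simp)]
    simp
  have ho₂ : σ₂.output = σ₁.output := hF₂.output
  simp only [Store.set_reg, if_true, Store.value_some]
  rcases hsw.eq_or_lt with heq | hlt
  · rw [List.getElem?_eq_none heq.ge]
    refine wp_pure ?_
    rw [heq] at hout
    simpa [ho₂] using hout
  · have hdrop := List.drop_eq_getElem_cons hlt
    rw [List.getElem?_eq_getElem hlt]
    generalize w[σ₁.reg (.inr .start)] = x at hdrop
    refine wp_bind (wp_searchTrivial hs₂ hsw hB (fun σ₃ hF₃ h1 h2 h3 => ?_) fun σ₃ hF₃ h => ?_)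
    · refine wp_bind (wp_copy (wp_pure ⟨⟨by simpa using h2, ?_⟩, by simp; omega⟩))
      simp only [Store.set_reg, if_true, Store.value_some, Store.set_output]
      rw [hF₃.output, ho₂, ← hout, ← List.take_append_drop (σ₃.reg (.inr .finish) -
        σ₁.reg (.inr .start)) (w.drop (σ₁.reg (.inr .start))), reduce_append_of_reduce_eq_nil h3,
        List.drop_drop, Nat.add_sub_cancel' h1.le]
    · have hs₃ : σ₃.reg (.inr .start) = σ₁.reg (.inr .start) := by
        rw [hF₃.reg _ (by simp), hs₂]
      refine wp_bind (wp_writeOutput (wp_bind (wp_add (by simp [hs₃]; omega) fun _ =>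
        wp_pure ⟨⟨by simp [hs₃]; omega, ?_⟩, by simp [hs₃]; omega⟩)))
      simp only [Store.set_reg, if_true, Store.value_none, Store.set_output, hs₃,
        Bool.toNat_true, add_zero]
      rw [hF₃.output, ho₂, ← hout, hdrop, reduce_cons_of_forall_prefix, List.append_assoc,
        List.singleton_append]
      intro v hv
      -- A trivial `x :: v` would be a factor ending at position `start + (v.length + 1)`, which the
      -- failed search excludes.
      have hpre : x :: v <+: w.drop (σ₁.reg (.inr .start)) := by
        rwa [hdrop, List.prefix_cons_inj]
      have hlen := hpre.length_le
      rw [List.length_drop, List.length_cons] at hlen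
      have := h (σ₁.reg (.inr .start) + (v.length + 1)) (by omega) (by omega)
      rwa [Nat.add_sub_cancel_left, ← List.length_cons, ← List.prefix_iff_eq_take.1 hpre] at this

end Test

end Fragment

/-! ### The space bound -/

theorem logspaceComputable_reduce (α : Type) [Fintype α] [DecidableEq α] :
    LogspaceComputable (FreeGroup.reduce : List (α × Bool) → List (α × Bool)) := by
  -- With `log n + 1 + d` digits, registers hold numbers below a power of two that is at least `(n +
  -- 1) * d`, because `n + 1 ≤ 2 ^ (log n + 1)` and `d ≤ 2 ^ d`. This exceeds twice the largest
  -- modulus.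
  set d := 2 * modulusFactor α + 2 with hd
  have key : ∀ w : List (α × Bool), 2 * (modulusFactor α * w.length) + 1 <
      2 ^ (Nat.log 2 w.length + 1 + d) := by
    intro w
    have h1 : w.length < 2 ^ (Nat.log 2 w.length + 1) := Nat.lt_pow_succ_log_self one_lt_two _
    have h2 : d < 2 ^ d := Nat.lt_two_pow_self
    rw [pow_add]
    refine lt_of_lt_of_le ?_ (Nat.mul_le_mul h1 h2.le)
    rw [hd, Nat.succ_eq_add_one]
    linarith [show (w.length + 1) * (2 * modulusFactor α + 2) =
      2 * (modulusFactor α * w.length) + 2 * w.length + 2 * modulusFactor α + 2 by ring]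
  -- The space is two squares more than the number of digits, `log n + d + 3` in all, which is at
  -- most `(d + 3) * (log n + 1)`.
  refine ⟨Fragment.writeReduced.toTransducer none, ⟨d + 3, fun w c hc => ?_⟩, fun w =>
    (Fragment.outputs_of_wp (Fragment.wp_writeReduced (key w))).1⟩
  refine ((Fragment.outputs_of_wp (Fragment.wp_writeReduced (key w))).2 c hc).trans_le ?_
  nlinarith [Nat.zero_le (d * Nat.log 2 w.length)]

/-! ### Reduced words as a normal form -/

theorem freeGroupLetter_eq_mk (k : ℕ) (x : Fin k × Bool) :
    freeGroupLetter k x = FreeGroup.mk [x] := by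
  obtain ⟨i, b⟩ := x
  cases b <;> rfl

theorem wordValue_freeGroupLetter (k : ℕ) (w : List (Fin k × Bool)) :
    wordValue (freeGroupLetter k) w = FreeGroup.mk w := by
  induction w with
  | nil => rfl
  | cons x w ih =>
    rw [wordValue, List.map_cons, List.prod_cons, freeGroupLetter_eq_mk]
    rw [wordValue] at ih
    rw [ih, FreeGroup.mul_mk, List.singleton_append]

theorem isSymmetricGeneratingSet_freeGroupLetter (k : ℕ) :
    IsSymmetricGeneratingSet (freeGroupLetter k) where
  injective x y h := by
    rw [freeGroupLetter_eq_mk, freeGroupLetter_eq_mk] at h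
    simpa [FreeGroup.reduce] using FreeGroup.reduce.sound h
  symmetric x := ⟨(x.1, !x.2), by
    rw [freeGroupLetter_eq_mk, freeGroupLetter_eq_mk, FreeGroup.inv_mk]
    rfl⟩
  generates := by
    rw [eq_top_iff, ← FreeGroup.closure_range_of]
    refine Subgroup.closure_mono ?_
    rintro _ ⟨i, rfl⟩
    exact ⟨(i, true), rfl⟩

theorem isNormalForm_isReduced (k : ℕ) :
    IsNormalForm (freeGroupLetter k) {w : List (Fin k × Bool) | FreeGroup.IsReduced w} where
  symmetricGenerating := isSymmetricGeneratingSet_freeGroupLetter k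
  bijOn := by
    refine ⟨fun _ _ => Set.mem_univ _, fun u hu v hv h => ?_, fun g _ => ?_⟩
    · rw [wordValue_freeGroupLetter, wordValue_freeGroupLetter] at h
      rw [← FreeGroup.IsReduced.reduce_eq hu, ← FreeGroup.IsReduced.reduce_eq hv]
      exact FreeGroup.reduce.sound h
    · exact ⟨g.toWord, FreeGroup.isReduced_toWord, by
        rw [wordValue_freeGroupLetter, FreeGroup.mk_toWord]⟩

/-- For the free group of finite rank `k`, the freely reduced words over the free generators and
their inverses are a normal form, and this normal form has a logspace normal form function. -/
theorem mainTheorem11 (k : ℕ) :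
    IsNormalForm (freeGroupLetter k) {w : List (Fin k × Bool) | FreeGroup.IsReduced w} ∧
      ∃ f : List (Fin k × Bool) → List (Fin k × Bool),
        IsLogspaceNormalFormFunction (freeGroupLetter k)
          {w : List (Fin k × Bool) | FreeGroup.IsReduced w} f := by
  refine ⟨isNormalForm_isReduced k, FreeGroup.reduce, logspaceComputable_reduce (Fin k),
    fun w => FreeGroup.IsReduced.of_reduce_eq FreeGroup.reduce.idem, fun w => ?_⟩
  rw [wordValue_freeGroupLetter, wordValue_freeGroupLetter, FreeGroup.reduce.self]
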